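/- Let $\langle z,w\rangle=\sum_{j=1}^d z_j\overline{w_j}$ and $|z|^2=\langle z,z\rangle$ on $\mathbb C^d$, and let $\mathcal F^2(\mathbb C^d)$ be the Fock space, i.e. the Hilbert space of all entire functions $f$ on $\mathbb C^d$ with $\|f\|^2=\pi^{-d}\int_{\mathbb C^d}|f(z)|^2e^{-|z|^2}\,dV(z)<\infty$, where $dV$ is Lebesgue measure. A conjugation on a Hilbert space is an antilinear map that is involutive and isometric. For a complex $d\times d$ matrix $A$, a vector $b\in\mathbb C^d$ and $c\in\mathbb C$ put $$\mathcal C_{A,b,c}f(z)=c\,e^{\langle z,\overline b\rangle}\,\overline{f\bigl(\overline{Az+b}\bigr)} .$$ Suppose that $\mathcal C=\mathcal C_{A,b,c}$ is a conjugation on $\mathcal F^2(\mathbb C^d)$, that $\psi$ is a nonzero entire function on $\mathbb C^d$ and that $\varphi:\mathbb C^d\to\mathbb C^d$ is holomorphic. The maximal weighted composition operator $C_{\psi,\varphi,\max}$ has domain $\{f\in\mathcal F^2(\mathbb C^d):\psi\cdot(f\circ\varphi)\in\mathcal F^2(\mathbb C^d)\}$ and acts on it by $f\mapsto\psi\cdot(f\circ\varphi)$.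 For linear operators $T,S$ on $\mathcal F^2(\mathbb C^d)$, not necessarily bounded or densely defined, $T\preceq S$ means that $\operatorname{dom}(T)\subseteq\operatorname{dom}(S)$ and $S$ extends $T$. An operator $S$ is called $\mathcal C$-selfadjoint if it is closed, densely defined and $S=\mathcal C S^*\mathcal C$ (with equality of domains). **Theorem.** (a) $C_{\psi,\varphi,\max}$ is $\mathcal C$-selfadjoint if and only if there are $\theta\in\mathbb C$, a complex $d\times d$ matrix $Q$ and vectors $q,\ell\in\mathbb C^d$ such that $$\psi(z)=\theta e^{\langle z,\ell\rangle},\qquad \varphi(z)=Qz+q\qquad(z\in\mathbb C^d),\qquad (AQ)^{t}=AQ,\qquad \ell=\overline{Aq}+\overline b-Q^*\overline b. \tag{1}$$ (b) A linear operator $C_{\psi,\varphi}$ on $\mathcal F^2(\mathbb C^d)$ with $C_{\psi,\varphi}\preceq C_{\psi,\varphi,\max}$ is $\mathcal C$-selfadjoint if and only if $C_{\psi,\varphi}=C_{\psi,\varphi,\max}$ and $\psi,\varphi$ are of the form (1). -/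

import Mathlib

noncomputable section

namespace FockCS

open MeasureTheory Filter Topology

/-- `ℂ^d` with its Hermitian inner product.  Mathlib's `inner ℂ x y` is conjugate-linear in `x`,
so that the pairing `⟨z, w⟩ = ∑ z_j conj(w_j)` of the text is `inner ℂ w z`. -/
abbrev CSpace (d : ℕ) : Type := EuclideanSpace ℂ (Fin d)

/-- The entire functions `f` on `ℂ^d` with `∫ |f(z)|² exp(-|z|²) dV(z) < ∞`. -/
def fockSubmodule (d : ℕ) : Submodule ℂ (CSpace d → ℂ) where
  carrier := {f | Differentiable ℂ f ∧
    Integrable (fun z : CSpace d => ‖f z‖ ^ 2 * Real.exp (-‖z‖ ^ 2))}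
  zero_mem' := ⟨differentiable_const 0, by simp⟩
  add_mem' := by
    rintro f g ⟨hf, hf'⟩ ⟨hg, hg'⟩
    refine ⟨hf.add hg, ((hf'.const_mul 2).add (hg'.const_mul 2)).mono' ?_ ?_⟩
    · have h := (hf.add hg).continuous
      exact Continuous.aestronglyMeasurable (by fun_prop)
    · refine Eventually.of_forall fun z => ?_
      have h1 : ‖f z + g z‖ ^ 2 ≤ 2 * ‖f z‖ ^ 2 + 2 * ‖g z‖ ^ 2 := by
        nlinarith [norm_add_le (f z) (g z), norm_nonneg (f z + g z), sq_nonneg (‖f z‖ - ‖g z‖)]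
      rw [Real.norm_of_nonneg (by positivity)]
      simp only [Pi.add_apply]
      nlinarith [Real.exp_pos (-‖z‖ ^ 2)]
  smul_mem' := by
    rintro c f ⟨hf, hf'⟩
    refine ⟨hf.const_smul c, (hf'.const_mul (‖c‖ ^ 2)).congr (Eventually.of_forall fun z => ?_)⟩
    simp only [Pi.smul_apply, smul_eq_mul, norm_mul]
    ring

/-- The Fock space `F²(ℂ^d)`. -/
def FockSpace (d : ℕ) : Type := fockSubmodule d

namespace FockSpace

variable {d : ℕ}

instance : AddCommGroup (FockSpace d) := inferInstanceAs (AddCommGroup (fockSubmodule d))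

instance : Module ℂ (FockSpace d) := inferInstanceAs (Module ℂ (fockSubmodule d))

instance : FunLike (FockSpace d) (CSpace d) ℂ where
  coe f := f.1
  coe_injective _ _ h := Subtype.ext h

/-- A function with the defining property, as an element of the Fock space. -/
def ofMem (f : CSpace d → ℂ) (hf : f ∈ fockSubmodule d) : FockSpace d := ⟨f, hf⟩

theorem coe_add (f g : FockSpace d) (z : CSpace d) : (f + g) z = f z + g z := rfl
theorem coe_sub (f g : FockSpace d) (z : CSpace d) : (f - g) z = f z - g z := rfl
theorem coe_zero (z : CSpace d) : (0 : FockSpace d) z = 0 := rfl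
theorem coe_smul (c : ℂ) (f : FockSpace d) (z : CSpace d) : (c • f) z = c * f z := rfl

theorem differentiable (f : FockSpace d) : Differentiable ℂ f := f.2.1

theorem integrable_sq (f : FockSpace d) :
    Integrable (fun z : CSpace d => ‖f z‖ ^ 2 * Real.exp (-‖z‖ ^ 2)) := f.2.2

theorem integrable_mul (f g : FockSpace d) : Integrable (fun z : CSpace d =>
    starRingEnd ℂ (f z) * g z * (Real.exp (-‖z‖ ^ 2) : ℂ)) := by
  refine (f.integrable_sq.add g.integrable_sq).mono' ?_ (Eventually.of_forall fun z => ?_)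
  · have := f.differentiable.continuous
    have := g.differentiable.continuous
    exact Continuous.aestronglyMeasurable (by fun_prop)
  · have h : ‖f z‖ * ‖g z‖ ≤ ‖f z‖ ^ 2 + ‖g z‖ ^ 2 := by
      nlinarith [sq_nonneg (‖f z‖ - ‖g z‖), sq_nonneg (‖f z‖), sq_nonneg (‖g z‖)]
    simp only [Pi.add_apply, norm_mul, RCLike.norm_conj, Complex.norm_real, Real.norm_eq_abs,
      Real.abs_exp]
    nlinarith [Real.exp_pos (-‖z‖ ^ 2)]

/-- The inner product `π^{-d} ∫ conj(f(z)) g(z) exp(-|z|²) dV(z)`, in Mathlib's convention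
(conjugate-linear in the first argument). -/
instance : Inner ℂ (FockSpace d) where
  inner f g := (1 / Real.pi ^ d : ℂ) *
    ∫ z : CSpace d, starRingEnd ℂ (f z) * g z * (Real.exp (-‖z‖ ^ 2) : ℂ)

theorem inner_def (f g : FockSpace d) : inner ℂ f g = (1 / Real.pi ^ d : ℂ) *
    ∫ z : CSpace d, starRingEnd ℂ (f z) * g z * (Real.exp (-‖z‖ ^ 2) : ℂ) := rfl

theorem inner_self_eq (f : FockSpace d) : inner ℂ f f =
    ((1 / Real.pi ^ d * ∫ z : CSpace d, ‖f z‖ ^ 2 * Real.exp (-‖z‖ ^ 2) : ℝ) : ℂ) := by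
  rw [inner_def]
  push_cast
  rw [← integral_complex_ofReal]
  congr 2
  ext z
  rw [Complex.conj_mul']
  push_cast
  rfl

theorem integral_nonneg (f : FockSpace d) :
    0 ≤ ∫ z : CSpace d, ‖f z‖ ^ 2 * Real.exp (-‖z‖ ^ 2) :=
  MeasureTheory.integral_nonneg fun z => by positivity

/-- The axioms of an inner product. -/
@[reducible] def core : InnerProductSpace.Core ℂ (FockSpace d) where
  conj_inner_symm f g := by
    rw [inner_def, inner_def, map_mul, ← integral_conj]
    simp only [map_mul, map_div₀, map_one, map_pow, Complex.conj_ofReal, Complex.conj_conj]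
    congr 2
    ext z
    ring
  re_inner_nonneg f := by
    rw [inner_self_eq]
    change 0 ≤ (Complex.ofReal _).re
    rw [Complex.ofReal_re]
    exact mul_nonneg (by positivity) f.integral_nonneg
  add_left f g h := by
    simp only [inner_def, coe_add, map_add, add_mul]
    rw [integral_add (f.integrable_mul h) (g.integrable_mul h), mul_add]
  smul_left f g c := by
    simp only [inner_def, coe_smul, map_mul, mul_assoc]
    rw [integral_const_mul]
    ring
  definite f hf := by
    rw [inner_self_eq] at hf
    have h0 : ∫ z : CSpace d, ‖f z‖ ^ 2 * Real.exp (-‖z‖ ^ 2) = 0 := by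
      have := Complex.ofReal_eq_zero.1 hf
      have hpi : (1 / Real.pi ^ d : ℝ) ≠ 0 := by positivity
      exact (mul_eq_zero.1 this).resolve_left hpi
    rw [integral_eq_zero_iff_of_nonneg (fun z => by positivity) f.integrable_sq] at h0
    have hc := f.differentiable.continuous
    have h1 := (Continuous.ae_eq_iff_eq volume (by fun_prop) continuous_const).1 h0
    refine DFunLike.ext _ _ fun z => ?_
    have h2 : ‖f z‖ ^ 2 * Real.exp (-‖z‖ ^ 2) = 0 := congrFun h1 z
    have h3 := (mul_eq_zero.1 h2).resolve_right (Real.exp_ne_zero _)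
    exact norm_eq_zero.1 ((pow_eq_zero_iff two_ne_zero).1 h3)

instance : NormedAddCommGroup (FockSpace d) :=
  core.toNormedAddCommGroup

instance : InnerProductSpace ℂ (FockSpace d) := InnerProductSpace.ofCore core.toCore

theorem norm_sq_eq (f : FockSpace d) :
    ‖f‖ ^ 2 = 1 / Real.pi ^ d * ∫ z : CSpace d, ‖f z‖ ^ 2 * Real.exp (-‖z‖ ^ 2) := by
  have h := inner_self_eq_norm_sq_to_K (𝕜 := ℂ) f
  rw [inner_self_eq] at h
  exact (Complex.ofReal_injective (h.trans (Complex.ofReal_pow _ _).symm)).symm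

theorem integral_eq (f : FockSpace d) :
    ∫ z : CSpace d, ‖f z‖ ^ 2 * Real.exp (-‖z‖ ^ 2) = Real.pi ^ d * ‖f‖ ^ 2 := by
  rw [norm_sq_eq]
  field_simp

/-- Mean value property of entire functions over the unit ball. -/
theorem integral_ball_eq {f : CSpace d → ℂ} (hf : Differentiable ℂ f) (z : CSpace d) :
    ∫ w in Metric.ball (0 : CSpace d) 1, f (z + w) =
      volume.real (Metric.ball (0 : CSpace d) 1) • f z := by
  set B := Metric.ball (0 : CSpace d) 1
  have hfc := hf.continuous
  have hB : (volume B) < ⊤ := Metric.isBounded_ball.measure_lt_top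
  have hrot : ∀ t : ℝ, ∫ w in B, f (z + circleMap 0 1 t • w) = ∫ w in B, f (z + w) := by
    intro t
    let e : CSpace d ≃ₗᵢ[ℝ] CSpace d :=
      { (LinearEquiv.smulOfNeZero ℂ (CSpace d) (circleMap 0 1 t)
          (circleMap_ne_center one_ne_zero)).restrictScalars ℝ with
        norm_map' := fun w => by
          change ‖circleMap 0 1 t • w‖ = ‖w‖
          rw [norm_smul]; simp }
    have h := e.measurePreserving.setIntegral_preimage_emb
      e.toHomeomorph.measurableEmbedding (fun w => f (z + w)) B
    have hpre : e ⁻¹' B = B := by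
      ext w
      simp [B]
    rw [hpre] at h
    exact h
  have havg : ∀ w : CSpace d,
      ∫ t in (0 : ℝ)..2 * Real.pi, f (z + circleMap 0 1 t • w) = (2 * Real.pi) • f z := by
    intro w
    have hg : Differentiable ℂ (fun s : ℂ => f (z + s • w)) := by fun_prop
    have h := DiffContOnCl.circleAverage (hg.diffContOnCl (s := Metric.ball 0 |1|))
    rw [Real.circleAverage_def] at h
    simp only [zero_smul, add_zero] at h
    rw [← h, smul_smul, mul_inv_cancel₀ (by positivity), one_smul]
  have hint : Integrable (Function.uncurry fun (t : ℝ) (w : CSpace d) =>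
      f (z + circleMap 0 1 t • w))
      ((volume.restrict (Set.uIoc 0 (2 * Real.pi))).prod (volume.restrict B)) := by
    rw [Measure.prod_restrict]
    have hcont : Continuous (Function.uncurry fun (t : ℝ) (w : CSpace d) =>
      f (z + circleMap 0 1 t • w)) := by
      unfold Function.uncurry circleMap
      fun_prop
    refine IntegrableOn.mono_set (t := Set.Icc 0 (2 * Real.pi) ×ˢ Metric.closedBall 0 1) ?_ ?_
    · exact hcont.continuousOn.integrableOn_compact
        (isCompact_Icc.prod (isCompact_closedBall _ _))
    · rw [Set.uIoc_of_le (by positivity)]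
      exact Set.prod_mono Set.Ioc_subset_Icc_self Metric.ball_subset_closedBall
  have h1 := intervalIntegral_integral_swap hint
  simp only [hrot, havg] at h1
  rw [intervalIntegral.integral_const, setIntegral_const, sub_zero, smul_comm] at h1
  have h2 : (2 * Real.pi) ≠ 0 := by positivity
  exact smul_right_injective ℂ h2 h1

/-- A bound for the point evaluations. -/
theorem exists_norm_apply_le (d : ℕ) : ∃ K : ℝ, 0 ≤ K ∧ ∀ (f : FockSpace d) (z : CSpace d),
    ‖f z‖ ≤ K * Real.exp ((‖z‖ + 1) ^ 2) * ‖f‖ := by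
  set B := Metric.ball (0 : CSpace d) 1
  have hBpos : 0 < volume.real B :=
    ENNReal.toReal_pos (Metric.measure_ball_pos _ _ one_pos).ne' measure_ball_lt_top.ne
  refine ⟨√(Real.pi ^ d / volume.real B), Real.sqrt_nonneg _, fun f z => ?_⟩
  have hfc := f.differentiable.continuous
  have h1 := integral_ball_eq (f.differentiable.pow 2) z
  have hI : Integrable (fun w : CSpace d => ‖f (z + w)‖ ^ 2 * Real.exp (-‖z + w‖ ^ 2)) :=
    f.integrable_sq.comp_add_left z
  have h2 : volume.real B * ‖f z‖ ^ 2 ≤ Real.exp ((‖z‖ + 1) ^ 2) * (Real.pi ^ d * ‖f‖ ^ 2) := by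
    calc volume.real B * ‖f z‖ ^ 2 = ‖∫ w in B, (f ^ 2 : CSpace d → ℂ) (z + w)‖ := by
          rw [h1, norm_smul, Real.norm_of_nonneg hBpos.le]
          simp
      _ ≤ ∫ w in B, Real.exp ((‖z‖ + 1) ^ 2) *
            (‖f (z + w)‖ ^ 2 * Real.exp (-‖z + w‖ ^ 2)) := by
          refine norm_integral_le_of_norm_le (hI.const_mul _).integrableOn ?_
          refine (ae_restrict_iff' Metric.isOpen_ball.measurableSet).2
            (Eventually.of_forall fun w hw => ?_)
          have hw' : ‖w‖ < 1 := by simpa [B] using hw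
          have h3 : ‖z + w‖ ≤ ‖z‖ + 1 := (norm_add_le _ _).trans (by linarith)
          have h4 : 1 ≤ Real.exp ((‖z‖ + 1) ^ 2) * Real.exp (-‖z + w‖ ^ 2) := by
            rw [← Real.exp_add]
            refine Real.one_le_exp ?_
            nlinarith [norm_nonneg (z + w)]
          simp only [Pi.pow_apply, norm_pow]
          nlinarith [sq_nonneg ‖f (z + w)‖]
      _ ≤ ∫ w, Real.exp ((‖z‖ + 1) ^ 2) *
            (‖f (z + w)‖ ^ 2 * Real.exp (-‖z + w‖ ^ 2)) :=
          setIntegral_le_integral (hI.const_mul _) (Eventually.of_forall fun w => by positivity)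
      _ = Real.exp ((‖z‖ + 1) ^ 2) * (Real.pi ^ d * ‖f‖ ^ 2) := by
          rw [integral_const_mul, ← integral_eq, integral_add_left_eq_self
            (fun w : CSpace d => ‖f w‖ ^ 2 * Real.exp (-‖w‖ ^ 2)) z]
  have h5 : ‖f z‖ ^ 2 ≤ (√(Real.pi ^ d / volume.real B) * Real.exp ((‖z‖ + 1) ^ 2) * ‖f‖) ^ 2 := by
    rw [mul_pow, mul_pow, Real.sq_sqrt (by positivity)]
    have h6 : Real.exp ((‖z‖ + 1) ^ 2) ≤ Real.exp ((‖z‖ + 1) ^ 2) ^ 2 := by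
      nlinarith [Real.one_le_exp (sq_nonneg (‖z‖ + 1))]
    have h7 : ‖f z‖ ^ 2 ≤ Real.exp ((‖z‖ + 1) ^ 2) * (Real.pi ^ d * ‖f‖ ^ 2) / volume.real B := by
      rw [le_div_iff₀ hBpos]; linarith
    refine h7.trans ?_
    rw [show Real.pi ^ d / volume.real B * Real.exp ((‖z‖ + 1) ^ 2) ^ 2 * ‖f‖ ^ 2 =
      Real.exp ((‖z‖ + 1) ^ 2) ^ 2 * (Real.pi ^ d * ‖f‖ ^ 2) / volume.real B by ring]
    gcongr
  exact le_of_sq_le_sq h5 (by positivity)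

/-- Cauchy's estimate for the derivative of an entire function. -/
theorem norm_fderiv_le {f : CSpace d → ℂ} (hf : Differentiable ℂ f) (z : CSpace d) {M : ℝ}
    (hM : ∀ w, ‖w‖ ≤ ‖z‖ + 1 → ‖f w‖ ≤ M) : ‖fderiv ℂ f z‖ ≤ M := by
  have hM0 : 0 ≤ M := (norm_nonneg _).trans (hM z (by linarith))
  refine ContinuousLinearMap.opNorm_le_bound _ hM0 fun v => ?_
  rcases eq_or_ne v 0 with rfl | hv
  · simp
  have hv' : 0 < ‖v‖ := norm_pos_iff.2 hv
  have hg : Differentiable ℂ (fun s : ℂ => f (z + s • v)) := by fun_prop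
  have hd : deriv (fun s : ℂ => f (z + s • v)) 0 = fderiv ℂ f z v := by
    have h1 : HasDerivAt (fun s : ℂ => z + s • v) v 0 := by
      simpa using ((hasDerivAt_id (0 : ℂ)).smul_const v).const_add z
    have h2 : HasFDerivAt f (fderiv ℂ f z) (z + (0 : ℂ) • v) := by
      simpa using (hf z).hasFDerivAt
    exact (h2.comp_hasDerivAt (0 : ℂ) h1).deriv
  have h := Complex.norm_deriv_le_of_forall_mem_sphere_norm_le (c := 0) (R := ‖v‖⁻¹) (C := M)
    (inv_pos.2 hv') hg.diffContOnCl (fun s hs => by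
      have hs' : ‖s‖ = ‖v‖⁻¹ := by simpa using hs
      refine hM _ ((norm_add_le _ _).trans ?_)
      rw [norm_smul, hs', inv_mul_cancel₀ hv'.ne'])
  rwa [hd, div_inv_eq_mul] at h

/-- The Fock space is complete. -/
instance : CompleteSpace (FockSpace d) := by
  refine Metric.complete_of_cauchySeq_tendsto fun u hu => ?_
  obtain ⟨K, hK0, hK⟩ := exists_norm_apply_le d
  have hu' := Metric.cauchySeq_iff.1 hu
  simp only [dist_eq_norm] at hu'
  have key : ∀ R : ℝ, 0 ≤ R → ∀ ε > 0, ∃ N, ∀ m ≥ N, ∀ n ≥ N, ∀ z : CSpace d, ‖z‖ ≤ R →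
      ‖u m z - u n z‖ < ε := by
    intro R hR ε hε
    obtain ⟨N, hN⟩ := hu' (ε / (K * Real.exp ((R + 1) ^ 2) + 1)) (by positivity)
    refine ⟨N, fun m hm n hn z hz => ?_⟩
    have h1 := hK (u m - u n) z
    rw [coe_sub] at h1
    refine h1.trans_lt ?_
    have h2 := hN m hm n hn
    rw [lt_div_iff₀ (by positivity)] at h2
    have h3 : Real.exp ((‖z‖ + 1) ^ 2) ≤ Real.exp ((R + 1) ^ 2) := by gcongr
    have h4 : K * Real.exp ((‖z‖ + 1) ^ 2) * ‖u m - u n‖ ≤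
        K * Real.exp ((R + 1) ^ 2) * ‖u m - u n‖ := by gcongr
    nlinarith [norm_nonneg (u m - u n)]
  have keyd : ∀ R : ℝ, 0 ≤ R → ∀ ε > 0, ∃ N, ∀ m ≥ N, ∀ n ≥ N, ∀ z : CSpace d, ‖z‖ ≤ R →
      ‖fderiv ℂ (u m) z - fderiv ℂ (u n) z‖ < ε := by
    intro R hR ε hε
    obtain ⟨N, hN⟩ := key (R + 1) (by positivity) (ε / 2) (by positivity)
    refine ⟨N, fun m hm n hn z hz => ?_⟩
    rw [← fderiv_sub ((u m).differentiable z) ((u n).differentiable z)]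
    refine (norm_fderiv_le ((u m).differentiable.sub (u n).differentiable) z (M := ε / 2)
      fun w hw => ?_).trans_lt (by linarith)
    exact (hN m hm n hn w (by linarith)).le
  have hlim : ∀ z, ∃ a, Tendsto (fun n => u n z) atTop (𝓝 a) := by
    intro z
    refine cauchySeq_tendsto_of_complete (Metric.cauchySeq_iff.2 fun ε hε => ?_)
    obtain ⟨N, hN⟩ := key ‖z‖ (norm_nonneg _) ε hε
    exact ⟨N, fun m hm n hn => by rw [dist_eq_norm]; exact hN m hm n hn z le_rfl⟩
  have hlimd : ∀ z, ∃ a, Tendsto (fun n => fderiv ℂ (u n) z) atTop (𝓝 a) := by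
    intro z
    refine cauchySeq_tendsto_of_complete (Metric.cauchySeq_iff.2 fun ε hε => ?_)
    obtain ⟨N, hN⟩ := keyd ‖z‖ (norm_nonneg _) ε hε
    exact ⟨N, fun m hm n hn => by rw [dist_eq_norm]; exact hN m hm n hn z le_rfl⟩
  choose g hg using hlim
  choose g' hg' using hlimd
  have hdiff : Differentiable ℂ g := by
    intro x
    have hun : TendstoUniformlyOn (fun n => fderiv ℂ (u n)) g' atTop (Metric.ball x 1) := by
      refine UniformCauchySeqOn.tendstoUniformlyOn_of_tendsto ?_ (fun z _ => hg' z)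
      refine Metric.uniformCauchySeqOn_iff.2 fun ε hε => ?_
      obtain ⟨N, hN⟩ := keyd (‖x‖ + 1) (by positivity) ε hε
      refine ⟨N, fun m hm n hn z hz => ?_⟩
      rw [dist_eq_norm]
      refine hN m hm n hn z ?_
      rw [Metric.mem_ball, dist_eq_norm] at hz
      have := norm_add_le x (z - x)
      rw [add_sub_cancel] at this
      linarith
    exact (hasFDerivAt_of_tendstoUniformlyOn Metric.isOpen_ball hun
      (fun n z _ => ((u n).differentiable z).hasFDerivAt) (fun z _ => hg z)
      (Metric.mem_ball_self one_pos)).differentiableAt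
  have hgc := hdiff.continuous
  have hfat : ∀ ε > 0, ∃ N, ∀ n ≥ N,
      ∫⁻ z : CSpace d, ENNReal.ofReal (‖g z - u n z‖ ^ 2 * Real.exp (-‖z‖ ^ 2)) ≤
        ENNReal.ofReal (Real.pi ^ d * ε ^ 2) := by
    intro ε hε
    obtain ⟨N, hN⟩ := hu' ε hε
    refine ⟨N, fun n hn => ?_⟩
    have hnc := (u n).differentiable.continuous
    have hpt : ∀ z : CSpace d, ENNReal.ofReal (‖g z - u n z‖ ^ 2 * Real.exp (-‖z‖ ^ 2)) =
        liminf (fun m => ENNReal.ofReal (‖u m z - u n z‖ ^ 2 * Real.exp (-‖z‖ ^ 2))) atTop := by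
      intro z
      refine (Tendsto.liminf_eq ?_).symm
      refine ENNReal.tendsto_ofReal ?_
      exact ((((hg z).sub_const _).norm).pow 2).mul_const _
    simp only [hpt]
    refine (lintegral_liminf_le fun m => ?_).trans ?_
    · have hmc := (u m).differentiable.continuous
      exact Measurable.ennreal_ofReal (Continuous.measurable (by fun_prop))
    · refine liminf_le_of_frequently_le' (Eventually.frequently ?_)
      filter_upwards [eventually_ge_atTop N] with m hm
      have h1 := integral_eq (u m - u n)
      have h2 := ofReal_integral_eq_lintegral_ofReal (u m - u n).integrable_sq
        (Eventually.of_forall fun z => by positivity)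
      simp only [coe_sub] at h1 h2
      rw [← h2, h1]
      refine ENNReal.ofReal_le_ofReal ?_
      have := (hN m hm n hn).le
      gcongr
  have hint : ∀ ε > 0, ∃ N, ∀ n ≥ N,
      Integrable (fun z : CSpace d => ‖g z - u n z‖ ^ 2 * Real.exp (-‖z‖ ^ 2)) ∧
      ∫ z : CSpace d, ‖g z - u n z‖ ^ 2 * Real.exp (-‖z‖ ^ 2) ≤ Real.pi ^ d * ε ^ 2 := by
    intro ε hε
    obtain ⟨N, hN⟩ := hfat ε hε
    refine ⟨N, fun n hn => ?_⟩
    have hnc := (u n).differentiable.continuous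
    have hI : Integrable (fun z : CSpace d => ‖g z - u n z‖ ^ 2 * Real.exp (-‖z‖ ^ 2)) := by
      refine ⟨Continuous.aestronglyMeasurable (by fun_prop), ?_⟩
      rw [hasFiniteIntegral_iff_ofReal (Eventually.of_forall fun z => by positivity)]
      exact (hN n hn).trans_lt ENNReal.ofReal_lt_top
    refine ⟨hI, ?_⟩
    have h2 := ofReal_integral_eq_lintegral_ofReal hI
      (Eventually.of_forall fun z => by positivity)
    have h3 := hN n hn
    rw [← h2] at h3
    exact (ENNReal.ofReal_le_ofReal_iff (by positivity)).1 h3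
  have hgmem : g ∈ fockSubmodule d := by
    obtain ⟨N, hN⟩ := hint 1 one_pos
    have h1 : (fun z => g z - u N z) ∈ fockSubmodule d :=
      ⟨hdiff.sub (u N).differentiable, (hN N le_rfl).1⟩
    have h2 := (fockSubmodule d).add_mem h1 (u N).2
    convert h2 using 1
    ext z
    change g z = g z - u N z + u N z
    ring
  refine ⟨ofMem g hgmem, Metric.tendsto_atTop.2 fun ε hε => ?_⟩
  obtain ⟨N, hN⟩ := hint (ε / 2) (by positivity)
  refine ⟨N, fun n hn => ?_⟩
  rw [dist_comm, dist_eq_norm]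
  set G := ofMem g hgmem
  have h1 : Real.pi ^ d * ‖G - u n‖ ^ 2 ≤ Real.pi ^ d * (ε / 2) ^ 2 := by
    rw [← integral_eq]
    exact (hN n hn).2
  have h2 : ‖G - u n‖ ^ 2 ≤ (ε / 2) ^ 2 := le_of_mul_le_mul_left h1 (by positivity)
  have h3 := le_of_sq_le_sq h2 (by positivity)
  linarith

end FockSpace

section Operators

variable {H : Type*} [NormedAddCommGroup H] [InnerProductSpace ℂ H]

/-- A conjugation on a Hilbert space: an antilinear map that is involutive and isometric. -/
def IsConjugation (C : H →ₗ⋆[ℂ] H) : Prop :=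
  Function.Involutive C ∧ ∀ f, ‖C f‖ = ‖f‖

/-- The composition `C T C` of an everywhere defined antilinear map `C` with an unbounded
operator `T`; its domain is `{f | C f ∈ dom T}`. -/
def conjBy (C : H →ₗ⋆[ℂ] H) (T : H →ₗ.[ℂ] H) : H →ₗ.[ℂ] H where
  domain := T.domain.comap C
  toFun :=
    { toFun := fun f => C (T ⟨C f.1, f.2⟩)
      map_add' := fun f g => by
        rw [← map_add, ← LinearPMap.map_add]
        congr 2
        exact Subtype.ext (map_add C f.1 g.1)
      map_smul' := fun a f => by
        have h : (⟨C (a • f).1, (a • f).2⟩ : T.domain) =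
            (starRingEnd ℂ a) • (⟨C f.1, f.2⟩ : T.domain) :=
          Subtype.ext (map_smulₛₗ C a f.1)
        rw [h, LinearPMap.map_smul, map_smulₛₗ, Complex.conj_conj, RingHom.id_apply] }

/-- A closed, densely defined operator `S` is `C`-selfadjoint if `S = C S* C`, including the
equality of the domains. -/
def IsCSelfAdjoint [CompleteSpace H] (C : H →ₗ⋆[ℂ] H) (S : H →ₗ.[ℂ] H) : Prop :=
  S.IsClosed ∧ Dense (S.domain : Set H) ∧ S = conjBy C S.adjoint

end Operators

variable {d : ℕ}

/-- The coordinatewise complex conjugate of a vector. -/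
def conjVec (z : CSpace d) : CSpace d := WithLp.toLp 2 fun j => starRingEnd ℂ (z j)

/-- The expression `c exp(⟨z, b̄⟩) conj(f(conj(A z + b)))`. -/
def conjExpr (A : Matrix (Fin d) (Fin d) ℂ) (b : CSpace d) (c : ℂ) (f : CSpace d → ℂ)
    (z : CSpace d) : ℂ :=
  c * Complex.exp (inner ℂ (conjVec b) z) *
    starRingEnd ℂ (f (conjVec (Matrix.toEuclideanLin A z + b)))

/-- The weighted composition expression `f ↦ ψ · (f ∘ φ)` on the Fock space, with values in the
functions on `ℂ^d`. -/
def wcExpr (ψ : CSpace d → ℂ) (φ : CSpace d → CSpace d) :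
    FockSpace d →ₗ[ℂ] (CSpace d → ℂ) where
  toFun f := fun z => ψ z * f (φ z)
  map_add' _ _ := funext fun _ => mul_add _ _ _
  map_smul' _ _ := funext fun _ => mul_left_comm _ _ _

/-- The maximal weighted composition operator: its domain consists of all `f` in the Fock space
for which `ψ · (f ∘ φ)` belongs to the Fock space. -/
def maxWCO (ψ : CSpace d → ℂ) (φ : CSpace d → CSpace d) : FockSpace d →ₗ.[ℂ] FockSpace d where
  domain := (fockSubmodule d).comap (wcExpr ψ φ)
  toFun :=
    { toFun := fun f => FockSpace.ofMem (wcExpr ψ φ f.1) f.2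
      map_add' := fun f g => Subtype.ext (map_add (wcExpr ψ φ) f.1 g.1)
      map_smul' := fun a f => Subtype.ext (map_smul (wcExpr ψ φ) a f.1) }

/-- The symbols have the form `ψ(z) = θ exp(⟨z, ℓ⟩)`, `φ(z) = Q z + q`, where `A Q` is a symmetric
matrix and `ℓ = conj(A q) + b̄ - Q* b̄`. -/
def HasCSForm (A : Matrix (Fin d) (Fin d) ℂ) (b : CSpace d) (ψ : CSpace d → ℂ)
    (φ : CSpace d → CSpace d) : Prop :=
  ∃ (θ : ℂ) (Q : Matrix (Fin d) (Fin d) ℂ) (q ℓ : CSpace d),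
    (∀ z, ψ z = θ * Complex.exp (inner ℂ ℓ z)) ∧
    (∀ z, φ z = Matrix.toEuclideanLin Q z + q) ∧
    (A * Q).transpose = A * Q ∧
    ℓ = conjVec (Matrix.toEuclideanLin A q) + conjVec b -
      Matrix.toEuclideanLin Q.conjTranspose (conjVec b)

end FockCS

end

noncomputable section

namespace FockCS

open MeasureTheory Filter Topology

variable {d : ℕ}

/-! Write K_w for the reproducing kernel and W for the maximal operator. Any densely defined
restriction T of W satisfies T* K_z = conj(ψ(z)) K_{φ(z)}. If also T = C T* C, then T maps C K_z to
ψ(z) C K_{φ(z)}. Evaluated at u this is `KernelEquation`, an identity between exponentials. Taking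
logarithms forces φ to be affine, ψ to be exponential and AQ to be symmetric
(`KernelEquation.hasCSForm`).

Conversely, the form (1) gives the kernel equation, hence density of the domain and C W* C ≤ W by
testing against the vectors C K_z. The hard inclusion W ≤ C T* C amounts to symmetry of the bilinear
form (f, h) ↦ ⟨Wf, C h⟩ on the whole domain of W, where kernels need not be dense in the graph norm.
It is proved in `HasCSForm.inner_map_eq` by dilation. With D_r contracting about 0 (with an
exponential weight) and D'_r contracting about q, one has D_r W f = W D'_r f. For small r both sides
depend boundedly on f, so the identity may be checked on kernels. Both sides of the resulting scalar
identity are holomorphic in |r| < 1, so it persists there, and r → 1 removes the dilation because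
the dilates stay bounded and converge weakly. -/

/-! ### Gaussian integrals and the Gaussian mean value property. -/

theorem integrable_exp_neg_sq_add_linear {a : ℝ} (ha : 0 < a) (B : ℝ) :
    Integrable fun z : CSpace d => Real.exp (-(a * ‖z‖ ^ 2) + B * ‖z‖) := by
  have h := GaussianFourier.integrable_cexp_neg_mul_sq_norm_add (V := CSpace d)
    (b := ((a / 2 : ℝ) : ℂ)) (by simpa using half_pos ha) 0 0
  -- Half of the Gaussian absorbs the linear term; the constant comes from completing the square.
  have h1 := (h.norm).const_mul (Real.exp (B ^ 2 / (2 * a)))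
  refine h1.mono' (Continuous.aestronglyMeasurable (by fun_prop)) (Eventually.of_forall fun z => ?_)
  rw [Real.norm_eq_abs, Real.abs_exp, Complex.norm_exp, ← Real.exp_add]
  refine Real.exp_le_exp.2 ?_
  have h2 : (-((a / 2 : ℝ) : ℂ) * (‖z‖ : ℂ) ^ 2 + 0 * (inner ℝ 0 z : ℝ)).re = -(a / 2 * ‖z‖ ^ 2) := by
    rw [← Complex.ofReal_pow, zero_mul, add_zero, ← Complex.ofReal_neg, ← Complex.ofReal_mul,
      Complex.ofReal_re]
    ring
  rw [h2]
  have h3 : 0 ≤ (a * ‖z‖ - B) ^ 2 / (2 * a) := by positivity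
  have h4 : (a * ‖z‖ - B) ^ 2 / (2 * a) = a / 2 * ‖z‖ ^ 2 - B * ‖z‖ + B ^ 2 / (2 * a) := by
    field_simp
    ring
  linarith

theorem integral_exp_neg_norm_sq (d : ℕ) :
    ∫ z : CSpace d, Real.exp (-‖z‖ ^ 2) = Real.pi ^ d := by
  have h := GaussianFourier.integral_rexp_neg_mul_sq_norm (V := CSpace d) one_pos
  have h1 : Module.finrank ℝ (CSpace d) = 2 * d := by
    rw [finrank_real_of_complex]
    simp
  rw [h1] at h
  simp only [neg_mul, one_mul, div_one] at h
  rw [h]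
  push_cast
  rw [mul_div_cancel_left₀ _ two_ne_zero, Real.rpow_natCast]

/-- Gaussian mean value property of entire functions. -/
theorem integral_mul_exp_neg_norm_sq {g : CSpace d → ℂ} (hg : Differentiable ℂ g)
    (hi : Integrable fun z : CSpace d => g z * (Real.exp (-‖z‖ ^ 2) : ℂ)) :
    ∫ z : CSpace d, g z * (Real.exp (-‖z‖ ^ 2) : ℂ) = Real.pi ^ d * g 0 := by
  have hgc := hg.continuous
  set G : CSpace d → ℂ := fun z => g z * (Real.exp (-‖z‖ ^ 2) : ℂ) with hG
  have hGc : Continuous G := by fun_prop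
  let e : ℝ → CSpace d ≃ₗᵢ[ℝ] CSpace d := fun t =>
    { (LinearEquiv.smulOfNeZero ℂ (CSpace d) (circleMap 0 1 t)
        (circleMap_ne_center one_ne_zero)).restrictScalars ℝ with
      norm_map' := fun w => by
        change ‖circleMap 0 1 t • w‖ = ‖w‖
        rw [norm_smul]; simp }
  -- Rotations by unit scalars preserve both the volume and the weight. Averaging over them reduces
  -- the claim to the one-variable mean value property on each complex line.
  have hrot : ∀ t : ℝ, ∫ w, G (circleMap 0 1 t • w) = ∫ w, G w := fun t =>
    (e t).measurePreserving.integral_comp (e t).toHomeomorph.measurableEmbedding G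
  have hroti : ∀ t : ℝ, Integrable fun w => G (circleMap 0 1 t • w) := fun t =>
    ((e t).measurePreserving.integrable_comp_emb (e t).toHomeomorph.measurableEmbedding).2 hi
  have hrotn : ∀ t : ℝ, ∫ w, ‖G (circleMap 0 1 t • w)‖ = ∫ w, ‖G w‖ := fun t =>
    (e t).measurePreserving.integral_comp (e t).toHomeomorph.measurableEmbedding fun w => ‖G w‖
  have havg : ∀ w : CSpace d, ∫ t in (0 : ℝ)..2 * Real.pi, G (circleMap 0 1 t • w) =
      (2 * Real.pi) • ((Real.exp (-‖w‖ ^ 2) : ℂ) * g 0) := by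
    intro w
    have hs : Differentiable ℂ (fun s : ℂ => g (s • w)) := by fun_prop
    have h := DiffContOnCl.circleAverage (hs.diffContOnCl (s := Metric.ball 0 |1|))
    rw [Real.circleAverage_def] at h
    simp only [zero_smul] at h
    have h2 : ∀ t, G (circleMap 0 1 t • w) =
        g (circleMap 0 1 t • w) * (Real.exp (-‖w‖ ^ 2) : ℂ) := by
      intro t
      simp only [hG, norm_smul, norm_circleMap_zero, abs_one, one_mul]
    simp only [h2]
    rw [intervalIntegral.integral_mul_const, ← h, mul_comm, mul_smul_comm, smul_smul,
      mul_inv_cancel₀ (by positivity), one_smul]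
  have hmeas : Continuous (Function.uncurry fun (t : ℝ) (w : CSpace d) =>
      G (circleMap 0 1 t • w)) := by
    unfold Function.uncurry circleMap
    fun_prop
  have hint : Integrable (Function.uncurry fun (t : ℝ) (w : CSpace d) =>
      G (circleMap 0 1 t • w)) ((volume.restrict (Set.uIoc 0 (2 * Real.pi))).prod volume) := by
    rw [integrable_prod_iff hmeas.aestronglyMeasurable]
    refine ⟨Eventually.of_forall fun t => hroti t, ?_⟩
    simp only [Function.uncurry, hrotn]
    rw [Set.uIoc_of_le (by positivity)]
    exact integrableOn_const measure_Ioc_lt_top.ne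
  have h1 := intervalIntegral_integral_swap hint
  simp only [hrot, havg] at h1
  rw [intervalIntegral.integral_const, sub_zero, integral_smul, integral_mul_const] at h1
  have h2 := smul_right_injective ℂ (r := 2 * Real.pi) (by positivity) h1
  rw [h2, integral_complex_ofReal, integral_exp_neg_norm_sq]
  push_cast
  rfl

/-! ### The reproducing kernel. -/

theorem norm_cexp_inner_le (w z : CSpace d) :
    ‖Complex.exp (inner ℂ w z)‖ ≤ Real.exp (‖w‖ * ‖z‖) := by
  rw [Complex.norm_exp]
  exact Real.exp_le_exp.2 ((Complex.re_le_norm _).trans (norm_inner_le_norm _ _))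

theorem differentiable_inner_right (w : CSpace d) :
    Differentiable ℂ fun z : CSpace d => inner ℂ w z :=
  (innerSL ℂ w).differentiable

theorem kernel_mem (w : CSpace d) :
    (fun z : CSpace d => Complex.exp (inner ℂ w z)) ∈ fockSubmodule d := by
  have hd := (differentiable_inner_right w).cexp
  have hc := hd.continuous
  refine ⟨hd, (integrable_exp_neg_sq_add_linear one_pos (2 * ‖w‖)).mono'
    (Continuous.aestronglyMeasurable (by fun_prop)) (Eventually.of_forall fun z => ?_)⟩
  rw [Real.norm_of_nonneg (by positivity)]
  calc ‖Complex.exp (inner ℂ w z)‖ ^ 2 * Real.exp (-‖z‖ ^ 2)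
      ≤ Real.exp (‖w‖ * ‖z‖) ^ 2 * Real.exp (-‖z‖ ^ 2) := by
        gcongr
        exact norm_cexp_inner_le w z
    _ = _ := by
        rw [← Real.exp_nat_mul, ← Real.exp_add]
        congr 1
        push_cast
        ring

/-- The reproducing kernel `z ↦ exp ⟨z, w⟩` of the Fock space. -/
def kernel (w : CSpace d) : FockSpace d := .ofMem _ (kernel_mem w)

theorem kernel_apply (w z : CSpace d) : kernel w z = Complex.exp (inner ℂ w z) := rfl

/-- Translation by w turns the integrand into the entire function f(z + w) e^{-⟨z,w⟩} times the
standard Gaussian; the mean value property then returns its value at 0. -/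
theorem inner_kernel (w : CSpace d) (f : FockSpace d) : inner ℂ (kernel w) f = f w := by
  have hsplit : ∀ z : CSpace d,
      starRingEnd ℂ (kernel w (z + w)) * f (z + w) * (Real.exp (-‖z + w‖ ^ 2) : ℂ) =
        (f (z + w) * Complex.exp (-inner ℂ w z)) * (Real.exp (-‖z‖ ^ 2) : ℂ) := by
    intro z
    have h1 : ((‖z + w‖ ^ 2 : ℝ) : ℂ) =
        (‖z‖ ^ 2 : ℝ) + inner ℂ z w + inner ℂ w z + inner ℂ w w := by
      have h0 : ∀ v : CSpace d, ((‖v‖ ^ 2 : ℝ) : ℂ) = inner ℂ v v := fun v =>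
        (Complex.ofReal_pow _ _).trans (inner_self_eq_norm_sq_to_K (𝕜 := ℂ) v).symm
      rw [h0, h0, inner_add_add_self]
    rw [kernel_apply, ← Complex.exp_conj, inner_conj_symm, Complex.ofReal_exp, Complex.ofReal_exp,
      mul_comm (Complex.exp _), mul_assoc, mul_assoc, ← Complex.exp_add, ← Complex.exp_add]
    congr 2
    rw [Complex.ofReal_neg, h1, inner_add_left]
    push_cast
    ring
  have hi := (FockSpace.integrable_mul (kernel w) f).comp_add_right w
  simp only [hsplit] at hi
  have hd : Differentiable ℂ fun z : CSpace d => f (z + w) * Complex.exp (-inner ℂ w z) :=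
    (f.differentiable.comp (differentiable_id.add_const w)).mul
      (differentiable_inner_right w).neg.cexp
  rw [FockSpace.inner_def, ← integral_add_right_eq_self _ w]
  simp only [hsplit]
  rw [integral_mul_exp_neg_norm_sq hd hi]
  have : (Real.pi : ℂ) ^ d ≠ 0 := pow_ne_zero _ (by exact_mod_cast Real.pi_ne_zero)
  field_simp
  simp

theorem norm_kernel_sq (w : CSpace d) : ‖kernel w‖ ^ 2 = Real.exp (‖w‖ ^ 2) := by
  have h := inner_self_eq_norm_sq_to_K (𝕜 := ℂ) (kernel w)
  rw [inner_kernel, kernel_apply, inner_self_eq_norm_sq_to_K (𝕜 := ℂ) w] at h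
  have h2 : ((Real.exp (‖w‖ ^ 2) : ℝ) : ℂ) = ((‖kernel w‖ ^ 2 : ℝ) : ℂ) := by
    push_cast
    exact h
  exact (Complex.ofReal_injective h2).symm

/-- The exact exponent matters: it makes |f(Mz + s)|² e^{-|z|²} integrable as soon as ‖M‖ < 1. -/
theorem norm_apply_sq_le (f : FockSpace d) (w : CSpace d) :
    ‖f w‖ ^ 2 ≤ Real.exp (‖w‖ ^ 2) * ‖f‖ ^ 2 := by
  rw [← norm_kernel_sq, ← mul_pow, ← inner_kernel]
  gcongr
  exact norm_inner_le_norm _ _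

theorem continuous_eval (w : CSpace d) : Continuous fun f : FockSpace d => f w := by
  simp only [← inner_kernel]
  fun_prop

/-! ### Density of kernels, weak convergence and weak holomorphy. -/

theorem dense_span_of_forall_eq_zero {s : Set (FockSpace d)}
    (h : ∀ f : FockSpace d, (∀ g ∈ s, inner ℂ g f = 0) → f = 0) :
    Dense (Submodule.span ℂ s : Set (FockSpace d)) := by
  rw [Submodule.dense_iff_topologicalClosure_eq_top, Submodule.topologicalClosure_eq_top_iff,
    Submodule.eq_bot_iff]
  exact fun f hf => h f fun g hg => (Submodule.mem_orthogonal _ f).1 hf g (Submodule.subset_span hg)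

theorem dense_span_kernel : Dense (Submodule.span ℂ (Set.range (kernel (d := d))) :
    Set (FockSpace d)) := by
  refine dense_span_of_forall_eq_zero fun f hf => DFunLike.ext _ _ fun z => ?_
  rw [← inner_kernel]
  exact hf _ ⟨z, rfl⟩

/-- A bounded family in the Fock space that converges pointwise converges weakly. -/
theorem tendsto_inner_of_bounded {ι : Type*} {l : Filter ι} {F : ι → FockSpace d}
    {f : FockSpace d} {B : ℝ} (hB : ∀ᶠ i in l, ‖F i‖ ≤ B)
    (hF : ∀ z, Tendsto (fun i => F i z) l (𝓝 (f z))) (u : FockSpace d) :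
    Tendsto (fun i => inner ℂ u (F i)) l (𝓝 (inner ℂ u f)) := by
  have hspan : ∀ v ∈ Submodule.span ℂ (Set.range (kernel (d := d))),
      Tendsto (fun i => inner ℂ v (F i)) l (𝓝 (inner ℂ v f)) := by
    intro v hv
    induction hv using Submodule.span_induction with
    | mem x hx =>
      obtain ⟨z, rfl⟩ := hx
      simpa only [inner_kernel] using hF z
    | zero => simp [tendsto_const_nhds]
    | add x y _ _ hx hy => simpa only [inner_add_left] using hx.add hy
    | smul a x _ hx => simpa only [inner_smul_left] using hx.const_mul _
  set B' := max B 0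
  rw [Metric.tendsto_nhds]
  intro ε hε
  obtain ⟨v, hv, huv⟩ := Metric.mem_closure_iff.1 (dense_span_kernel u)
    (ε / (2 * (B' + ‖f‖ + 1))) (by positivity)
  rw [dist_eq_norm, lt_div_iff₀ (by positivity)] at huv
  filter_upwards [hB, Metric.tendsto_nhds.1 (hspan v hv) (ε / 2) (by positivity)] with i h1 h2
  rw [dist_eq_norm] at h2 ⊢
  have h3 : inner ℂ u (F i) - inner ℂ u f =
      inner ℂ (u - v) (F i - f) + (inner ℂ v (F i) - inner ℂ v f) := by
    simp only [inner_sub_left, inner_sub_right]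
    ring
  have h4 : ‖F i - f‖ ≤ B' + ‖f‖ := 
    (norm_sub_le _ _).trans (by gcongr; exact h1.trans (le_max_left _ _))
  have h5 : ‖inner ℂ (u - v) (F i - f)‖ ≤ ‖u - v‖ * (B' + ‖f‖) :=
    (norm_inner_le_norm _ _).trans (by gcongr)
  rw [h3]
  refine (norm_add_le _ _).trans_lt ?_
  nlinarith [norm_nonneg (u - v)]

/-- A locally bounded family in the Fock space that depends holomorphically on a parameter at each
point of `ℂ^d` is weakly holomorphic. -/
theorem differentiableOn_inner {U : Set ℂ} (hU : IsOpen U) {F : ℂ → FockSpace d}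
    (hB : ∀ r ∈ U, ∃ B : ℝ, ∀ᶠ s in 𝓝 r, ‖F s‖ ≤ B)
    (hF : ∀ z, DifferentiableOn ℂ (fun s => F s z) U) (u : FockSpace d) :
    DifferentiableOn ℂ (fun s => inner ℂ u (F s)) U := by
  have hspan : ∀ v ∈ Submodule.span ℂ (Set.range (kernel (d := d))),
      DifferentiableOn ℂ (fun s => inner ℂ v (F s)) U := by
    intro v hv
    induction hv using Submodule.span_induction with
    | mem x hx =>
      obtain ⟨z, rfl⟩ := hx
      simpa only [inner_kernel] using hF z
    | zero => simp
    | add x y _ _ hx hy => simpa only [inner_add_left] using hx.fun_add hy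
    | smul a x _ hx => simpa only [inner_smul_left] using hx.const_mul _
  -- Local boundedness of F makes the pairings with v n converge locally uniformly, so holomorphy
  -- passes to the limit.
  obtain ⟨v, hv, hlim⟩ := mem_closure_iff_seq_limit.1 (dense_span_kernel u)
  refine TendstoLocallyUniformlyOn.differentiableOn (φ := atTop)
    (F := fun n s => inner ℂ (v n) (F s)) ?_ (Eventually.of_forall fun n => hspan _ (hv n)) hU
  rw [Metric.tendstoLocallyUniformlyOn_iff]
  intro ε hε r hr
  obtain ⟨B, hB⟩ := hB r hr
  refine ⟨_, mem_nhdsWithin_of_mem_nhds hB, ?_⟩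
  set B' := max B 0
  filter_upwards [Metric.tendsto_nhds.1 hlim (ε / (B' + 1)) (by positivity)] with n hn s hs
  rw [dist_eq_norm, lt_div_iff₀ (by positivity)] at hn
  rw [dist_eq_norm, ← inner_sub_left]
  refine (norm_inner_le_norm _ _).trans_lt ?_
  rw [norm_sub_rev]
  have h4 : ‖F s‖ ≤ B' := le_trans hs (le_max_left _ _)
  nlinarith [norm_nonneg (v n - u)]

/-! ### Bounded weighted composition operators with contractive linear part. -/

/-- The exponent is 2R|z| + (ρ|z| + R)² - |z|². It depends on M, p, s only through ρ and R, so the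
resulting operator bound is uniform in these parameters. -/
theorem gauss_integrand_le {M : CSpace d →L[ℂ] CSpace d} {ρ R : ℝ} (hM : ‖M‖ ≤ ρ)
    {p s : CSpace d} (hp : ‖p‖ ≤ R) (hs : ‖s‖ ≤ R) (f : FockSpace d) (z : CSpace d) :
    ‖Complex.exp (inner ℂ p z) * f (M z + s)‖ ^ 2 * Real.exp (-‖z‖ ^ 2) ≤
      Real.exp (R ^ 2) * ‖f‖ ^ 2 *
        Real.exp (-((1 - ρ ^ 2) * ‖z‖ ^ 2) + (2 * R + 2 * ρ * R) * ‖z‖) := by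
  have hR : 0 ≤ R := (norm_nonneg _).trans hp
  have hρ : 0 ≤ ρ := (norm_nonneg _).trans hM
  have h1 : ‖M z + s‖ ≤ ρ * ‖z‖ + R :=
    (norm_add_le _ _).trans (add_le_add ((M.le_opNorm z).trans (by gcongr)) hs)
  have h2 : ‖Complex.exp (inner ℂ p z)‖ ≤ Real.exp (R * ‖z‖) :=
    (norm_cexp_inner_le p z).trans (by gcongr)
  rw [norm_mul, mul_pow]
  calc ‖Complex.exp (inner ℂ p z)‖ ^ 2 * ‖f (M z + s)‖ ^ 2 * Real.exp (-‖z‖ ^ 2)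
      ≤ Real.exp (R * ‖z‖) ^ 2 * (Real.exp ((ρ * ‖z‖ + R) ^ 2) * ‖f‖ ^ 2) *
          Real.exp (-‖z‖ ^ 2) := by
        have h3 : Real.exp (‖M z + s‖ ^ 2) ≤ Real.exp ((ρ * ‖z‖ + R) ^ 2) := by gcongr
        have h4 := (norm_apply_sq_le f (M z + s)).trans
          (mul_le_mul_of_nonneg_right h3 (sq_nonneg ‖f‖))
        gcongr
    _ = ‖f‖ ^ 2 * (Real.exp (R * ‖z‖) ^ 2 * Real.exp ((ρ * ‖z‖ + R) ^ 2) *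
          Real.exp (-‖z‖ ^ 2)) := by ring
    _ = ‖f‖ ^ 2 * (Real.exp (R ^ 2) *
        Real.exp (-((1 - ρ ^ 2) * ‖z‖ ^ 2) + (2 * R + 2 * ρ * R) * ‖z‖)) := by
        rw [← Real.exp_nat_mul, ← Real.exp_add, ← Real.exp_add, ← Real.exp_add]
        congr 2
        push_cast
        ring
    _ = _ := by ring

theorem gauss_mem {M : CSpace d →L[ℂ] CSpace d} (hM : ‖M‖ < 1) (p s : CSpace d)
    (f : FockSpace d) :
    (fun z => Complex.exp (inner ℂ p z) * f (M z + s)) ∈ fockSubmodule d := by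
  have hd : Differentiable ℂ fun z => Complex.exp (inner ℂ p z) * f (M z + s) :=
    (differentiable_inner_right p).cexp.mul
      (f.differentiable.comp (M.differentiable.add_const s))
  have hc := hd.continuous
  have hpos : 0 < 1 - ‖M‖ ^ 2 := by nlinarith [norm_nonneg M]
  refine ⟨hd, Integrable.mono' ((integrable_exp_neg_sq_add_linear hpos _).const_mul _)
    (Continuous.aestronglyMeasurable (by fun_prop)) (Eventually.of_forall fun z =>
      (Real.norm_of_nonneg (by positivity)).trans_le
        (gauss_integrand_le le_rfl (le_max_left ‖p‖ ‖s‖) (le_max_right ‖p‖ ‖s‖) f z))⟩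

/-- The bound for the norm of the weighted composition operators with `‖M‖ ≤ ρ`. -/
def gaussBound (d : ℕ) (ρ R : ℝ) : ℝ :=
  √(1 / Real.pi ^ d * (Real.exp (R ^ 2) * ∫ z : CSpace d,
    Real.exp (-((1 - ρ ^ 2) * ‖z‖ ^ 2) + (2 * R + 2 * ρ * R) * ‖z‖)))

theorem norm_gauss_le {M : CSpace d →L[ℂ] CSpace d} {ρ R : ℝ} (hM : ‖M‖ ≤ ρ) (hρ : ρ < 1)
    {p s : CSpace d} (hp : ‖p‖ ≤ R) (hs : ‖s‖ ≤ R) (f : FockSpace d) :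
    ‖FockSpace.ofMem _ (gauss_mem (hM.trans_lt hρ) p s f)‖ ≤ gaussBound d ρ R * ‖f‖ := by
  have hpos : 0 < 1 - ρ ^ 2 := by nlinarith [(norm_nonneg _).trans hM]
  refine le_of_sq_le_sq ?_ (mul_nonneg (Real.sqrt_nonneg _) (norm_nonneg _))
  rw [mul_pow, gaussBound, Real.sq_sqrt (mul_nonneg (by positivity)
    (mul_nonneg (Real.exp_pos _).le (integral_nonneg fun z => (Real.exp_pos _).le))),
    FockSpace.norm_sq_eq, mul_assoc]
  refine mul_le_mul_of_nonneg_left ?_ (by positivity)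
  rw [mul_right_comm, ← integral_const_mul]
  exact integral_mono (FockSpace.integrable_sq _)
    ((integrable_exp_neg_sq_add_linear hpos _).const_mul _)
    fun z => gauss_integrand_le hM hp hs f z

/-- The bounded weighted composition operator `f ↦ exp ⟨z, p⟩ f (M z + s)`, for `‖M‖ < 1`. -/
def gaussOp (M : CSpace d →L[ℂ] CSpace d) (hM : ‖M‖ < 1) (p s : CSpace d) :
    FockSpace d →L[ℂ] FockSpace d :=
  LinearMap.mkContinuous
    { toFun := fun f => FockSpace.ofMem _ (gauss_mem hM p s f)
      map_add' := fun f g => DFunLike.ext _ _ fun z =>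
        mul_add (Complex.exp (inner ℂ p z)) (f (M z + s)) (g (M z + s))
      map_smul' := fun a f => DFunLike.ext _ _ fun z =>
        mul_left_comm (Complex.exp (inner ℂ p z)) a (f (M z + s)) }
    (gaussBound d ‖M‖ (max ‖p‖ ‖s‖))
    fun f => norm_gauss_le le_rfl hM (le_max_left _ _) (le_max_right _ _) f

theorem gaussOp_apply (M : CSpace d →L[ℂ] CSpace d) (hM : ‖M‖ < 1) (p s : CSpace d)
    (f : FockSpace d) (z : CSpace d) :
    gaussOp M hM p s f z = Complex.exp (inner ℂ p z) * f (M z + s) := rfl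

theorem norm_gaussOp_le {M : CSpace d →L[ℂ] CSpace d} {ρ R : ℝ} (hM : ‖M‖ ≤ ρ) (hρ : ρ < 1)
    {p s : CSpace d} (hp : ‖p‖ ≤ R) (hs : ‖s‖ ≤ R) (f : FockSpace d) :
    ‖gaussOp M (hM.trans_lt hρ) p s f‖ ≤ gaussBound d ρ R * ‖f‖ :=
  norm_gauss_le hM hρ hp hs f

theorem norm_smul_id_le (r : ℂ) : ‖r • ContinuousLinearMap.id ℂ (CSpace d)‖ ≤ ‖r‖ :=
  ContinuousLinearMap.opNorm_le_bound _ (norm_nonneg _) fun v => (norm_smul r v).le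

/-! ### Dilations and their weak limit. -/

open Classical in
/-- The function `z ↦ exp ((1 - r) ⟨z, p⟩) f (r z + (1 - r) s)` for `|r| < 1`, and zero for the
other values of `r`. -/
def dilate (p s : CSpace d) (f : FockSpace d) (r : ℂ) : FockSpace d :=
  if h : ‖r‖ < 1 then
    gaussOp (r • ContinuousLinearMap.id ℂ (CSpace d)) ((norm_smul_id_le r).trans_lt h)
      -- The pairing is antilinear in its second vector; the conjugate makes the exponent (1 - r)⟨z,
      -- p⟩ holomorphic in r.
      (starRingEnd ℂ (1 - r) • p) ((1 - r) • s) f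
  else 0

theorem dilate_apply (p s : CSpace d) (f : FockSpace d) {r : ℂ} (hr : ‖r‖ < 1) (z : CSpace d) :
    dilate p s f r z = Complex.exp ((1 - r) * inner ℂ p z) * f (r • z + (1 - r) • s) := by
  rw [dilate, dif_pos hr, gaussOp_apply, inner_smul_left, Complex.conj_conj]
  rfl

theorem differentiableOn_inner_dilate (p s : CSpace d) (f u : FockSpace d) :
    DifferentiableOn ℂ (fun r => inner ℂ u (dilate p s f r)) (Metric.ball 0 1) := by
  refine differentiableOn_inner Metric.isOpen_ball (fun r hr => ?_) (fun z => ?_) u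
  · rw [mem_ball_zero_iff] at hr
    -- The midpoint between |r| and 1 leaves room for a neighbourhood of r; the factor 2 bounds |1 -
    -- t| in the disc.
    refine ⟨gaussBound d ((1 + ‖r‖) / 2) (2 * (‖p‖ + ‖s‖)) * ‖f‖, ?_⟩
    have h1 : ∀ᶠ t : ℂ in 𝓝 r, ‖t‖ < (1 + ‖r‖) / 2 :=
      (continuous_norm.tendsto r).eventually_lt_const (by linarith)
    filter_upwards [h1] with t ht
    have ht1 : ‖t‖ < 1 := by linarith
    have h2 : ‖1 - t‖ ≤ 2 := (norm_sub_le _ _).trans (by rw [norm_one]; linarith)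
    rw [dilate, dif_pos ht1]
    refine norm_gaussOp_le ((norm_smul_id_le t).trans ht.le) (by linarith) ?_ ?_ f
    · rw [norm_smul, RCLike.norm_conj]
      nlinarith [norm_nonneg p, norm_nonneg s]
    · rw [norm_smul]
      nlinarith [norm_nonneg p, norm_nonneg s]
  · have h : Differentiable ℂ fun r : ℂ =>
        Complex.exp ((1 - r) * inner ℂ p z) * f (r • z + (1 - r) • s) := by
      have := f.differentiable
      fun_prop
    exact h.differentiableOn.congr fun r hr => dilate_apply p s f (mem_ball_zero_iff.1 hr) z

/-- A bound uniform as r → 1, where the operator bound above gives no control. The substitution w =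
rz + (1 - r)s carries the integral back to that of f, and its Jacobian is bounded because r ≥ 1/2.
-/
theorem norm_dilate_sq_le (p s : CSpace d) (f : FockSpace d) {r : ℝ} (hr : 1 / 2 ≤ r)
    (hr1 : r < 1) :
    ‖dilate p s f r‖ ^ 2 ≤ Real.exp ((‖p‖ + ‖s‖) ^ 2 + ‖s‖ ^ 2) *
      2 ^ Module.finrank ℝ (CSpace d) * ‖f‖ ^ 2 := by
  have hr0 : 0 < r := by linarith
  have hrn : ‖(r : ℂ)‖ < 1 := by rwa [Complex.norm_real, Real.norm_of_nonneg hr0.le]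
  set K := (‖p‖ + ‖s‖) ^ 2 + ‖s‖ ^ 2
  set H : CSpace d → ℝ := fun w => ‖f w‖ ^ 2 * Real.exp (-‖w‖ ^ 2) with hH
  set v : CSpace d := (1 - (r : ℂ)) • s
  have hvn : ‖v‖ = (1 - r) * ‖s‖ := by
    rw [norm_smul, ← Complex.ofReal_one, ← Complex.ofReal_sub, Complex.norm_real,
      Real.norm_of_nonneg (by linarith)]
  have hpt : ∀ z : CSpace d, ‖dilate p s f r z‖ ^ 2 * Real.exp (-‖z‖ ^ 2) ≤
      Real.exp K * H (r • z + v) := by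
    intro z
    have h1 : ‖r • z + v‖ ≤ r * ‖z‖ + (1 - r) * ‖s‖ := by
      refine (norm_add_le _ _).trans ?_
      rw [hvn, norm_smul, Real.norm_of_nonneg hr0.le]
    have h2 : ‖Complex.exp ((1 - (r : ℂ)) * inner ℂ p z)‖ ≤ Real.exp ((1 - r) * (‖p‖ * ‖z‖)) := by
      rw [Complex.norm_exp, ← Complex.ofReal_one, ← Complex.ofReal_sub, Complex.re_ofReal_mul]
      have := (Complex.re_le_norm _).trans (norm_inner_le_norm (𝕜 := ℂ) p z)
      have h3 : 0 ≤ 1 - r := by linarith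
      gcongr
    -- The gain (1 - r²)|z|² carries the same factor 1 - r as the terms linear in |z|, so it absorbs
    -- them at a cost K independent of r.
    have h3 : ‖r • z + v‖ ^ 2 + 2 * ((1 - r) * (‖p‖ * ‖z‖)) ≤ ‖z‖ ^ 2 + K := by
      have h4 : ‖r • z + v‖ ^ 2 ≤ (r * ‖z‖ + (1 - r) * ‖s‖) ^ 2 := by gcongr
      have h5 : 0 ≤ (1 - r) * (‖z‖ - (‖p‖ + ‖s‖)) ^ 2 :=
        mul_nonneg (by linarith) (sq_nonneg _)
      have h6 : 0 ≤ (1 - r) * (1 - r) * (‖z‖ * ‖s‖) :=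
        mul_nonneg (mul_self_nonneg _) (by positivity)
      have h7 : 0 ≤ r * (‖p‖ + ‖s‖) ^ 2 := by positivity
      have h8 : 0 ≤ r * (1 - r) * ‖z‖ ^ 2 :=
        mul_nonneg (mul_nonneg hr0.le (by linarith)) (sq_nonneg _)
      have h9 : 0 ≤ r * (2 - r) * ‖s‖ ^ 2 :=
        mul_nonneg (mul_nonneg hr0.le (by linarith)) (sq_nonneg _)
      simp only [K]
      nlinarith
    rw [dilate_apply p s f hrn, norm_mul, mul_pow, Complex.coe_smul]
    calc ‖Complex.exp ((1 - (r : ℂ)) * inner ℂ p z)‖ ^ 2 * ‖f (r • z + v)‖ ^ 2 *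
          Real.exp (-‖z‖ ^ 2)
        ≤ Real.exp ((1 - r) * (‖p‖ * ‖z‖)) ^ 2 * ‖f (r • z + v)‖ ^ 2 * Real.exp (-‖z‖ ^ 2) := by
          gcongr
      _ = ‖f (r • z + v)‖ ^ 2 * (Real.exp ((1 - r) * (‖p‖ * ‖z‖)) ^ 2 * Real.exp (-‖z‖ ^ 2)) := by
          ring
      _ ≤ ‖f (r • z + v)‖ ^ 2 * (Real.exp K * Real.exp (-‖r • z + v‖ ^ 2)) := by
          rw [← Real.exp_nat_mul, ← Real.exp_add, ← Real.exp_add]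
          refine mul_le_mul_of_nonneg_left (Real.exp_le_exp.2 ?_) (sq_nonneg _)
          push_cast
          linarith
      _ = _ := by
          simp only [hH]
          ring
  have hHi : Integrable H := f.integrable_sq
  have hi : Integrable fun z : CSpace d => H (r • z + v) :=
    (hHi.comp_add_right v).comp_smul hr0.ne'
  have hval : ∫ z : CSpace d, H (r • z + v) =
      |(r ^ Module.finrank ℝ (CSpace d))⁻¹| * (Real.pi ^ d * ‖f‖ ^ 2) := by
    rw [Measure.integral_comp_smul volume (fun w => H (w + v)) r, integral_add_right_eq_self H v,
      ← FockSpace.integral_eq, smul_eq_mul]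
  have hle : |(r ^ Module.finrank ℝ (CSpace d))⁻¹| ≤ 2 ^ Module.finrank ℝ (CSpace d) := by
    rw [abs_of_nonneg (by positivity), ← inv_pow]
    gcongr
    rw [inv_le_comm₀ hr0 two_pos]
    linarith
  have hpi : 0 < Real.pi ^ d := by positivity
  refine le_of_mul_le_mul_left ?_ hpi
  rw [← FockSpace.integral_eq]
  calc ∫ z : CSpace d, ‖dilate p s f r z‖ ^ 2 * Real.exp (-‖z‖ ^ 2)
      ≤ ∫ z : CSpace d, Real.exp K * H (r • z + v) :=
        integral_mono (FockSpace.integrable_sq _) (hi.const_mul _) hpt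
    _ = Real.exp K * (|(r ^ Module.finrank ℝ (CSpace d))⁻¹| * (Real.pi ^ d * ‖f‖ ^ 2)) := by
        rw [integral_const_mul, hval]
    _ ≤ Real.exp K * (2 ^ Module.finrank ℝ (CSpace d) * (Real.pi ^ d * ‖f‖ ^ 2)) := by gcongr
    _ = _ := by ring

theorem tendsto_inner_dilate (p s : CSpace d) (f u : FockSpace d) :
    Tendsto (fun r : ℝ => inner ℂ u (dilate p s f r)) (𝓝[<] 1) (𝓝 (inner ℂ u f)) := by
  have hlt : ∀ᶠ r : ℝ in 𝓝[<] 1, r < 1 := self_mem_nhdsWithin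
  have hge : ∀ᶠ r : ℝ in 𝓝[<] 1, 1 / 2 ≤ r :=
    mem_nhdsWithin_of_mem_nhds (eventually_ge_nhds (by norm_num))
  refine tendsto_inner_of_bounded (B := √(Real.exp ((‖p‖ + ‖s‖) ^ 2 + ‖s‖ ^ 2) *
      2 ^ Module.finrank ℝ (CSpace d) * ‖f‖ ^ 2)) ?_ (fun z => ?_) u
  · filter_upwards [hlt, hge] with r h1 h2
    exact Real.le_sqrt_of_sq_le (norm_dilate_sq_le p s f h2 h1)
  · have hf := f.differentiable.continuous
    have h : Continuous fun r : ℝ => Complex.exp ((1 - (r : ℂ)) * inner ℂ p z) *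
        f ((r : ℂ) • z + (1 - (r : ℂ)) • s) := by fun_prop
    have h1 := (h.tendsto 1).mono_left (nhdsWithin_le_nhds (s := Set.Iio 1))
    simp only [Complex.ofReal_one, sub_self, zero_mul, Complex.exp_zero, one_mul, one_smul,
      zero_smul, add_zero] at h1
    refine h1.congr' ?_
    filter_upwards [hlt, hge] with r h1 h2
    refine (dilate_apply p s f ?_ z).symm
    rwa [Complex.norm_real, Real.norm_of_nonneg (by linarith)]

/-! ### The bilinear pairing, and logarithms of exponential identities. -/

section Pairing

/-- The bilinear pairing `∑ x_j y_j`. -/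
def pairing (x y : CSpace d) : ℂ := ∑ j, x j * y j

theorem pairing_comm (x y : CSpace d) : pairing x y = pairing y x :=
  Finset.sum_congr rfl fun _ _ => mul_comm _ _

theorem inner_conjVec (x y : CSpace d) : inner ℂ (conjVec y) x = pairing x y := by
  simp [pairing, conjVec, PiLp.inner_apply]

theorem conjVec_conjVec (x : CSpace d) : conjVec (conjVec x) = x := by
  ext j
  simp [conjVec]

theorem conj_pairing (x y : CSpace d) :
    starRingEnd ℂ (pairing x y) = pairing (conjVec x) (conjVec y) := by
  simp [pairing, conjVec]

theorem inner_eq_pairing (x y : CSpace d) : inner ℂ y x = pairing x (conjVec y) := by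
  rw [← inner_conjVec, conjVec_conjVec]

theorem pairing_add_left (x y z : CSpace d) : pairing (x + y) z = pairing x z + pairing y z := by
  simp [pairing, add_mul, Finset.sum_add_distrib]

theorem pairing_smul_left (a : ℂ) (x z : CSpace d) : pairing (a • x) z = a * pairing x z := by
  simp [pairing, Finset.mul_sum, mul_assoc]

theorem pairing_sub_left (x y z : CSpace d) : pairing (x - y) z = pairing x z - pairing y z := by
  simp [pairing, sub_mul, Finset.sum_sub_distrib]

theorem pairing_add_right (x y z : CSpace d) : pairing x (y + z) = pairing x y + pairing x z := by
  simp only [pairing_comm x, pairing_add_left]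

theorem pairing_sub_right (x y z : CSpace d) : pairing x (y - z) = pairing x y - pairing x z := by
  simp only [pairing_comm x, pairing_sub_left]

theorem pairing_zero_left (x : CSpace d) : pairing 0 x = 0 := by simp [pairing]

theorem pairing_zero_right (x : CSpace d) : pairing x 0 = 0 := by simp [pairing]

theorem ext_pairing {x y : CSpace d} (h : ∀ z, pairing x z = pairing y z) : x = y := by
  ext j
  simpa [pairing] using h (EuclideanSpace.single j 1)

theorem pairing_toEuclideanLin (M : Matrix (Fin d) (Fin d) ℂ) (x y : CSpace d) :
    pairing (Matrix.toEuclideanLin M x) y = pairing x (Matrix.toEuclideanLin M.transpose y) := by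
  simp only [pairing, Matrix.toLpLin_apply, Matrix.mulVec, dotProduct, Finset.sum_mul,
    Finset.mul_sum, Matrix.transpose_apply]
  rw [Finset.sum_comm]
  exact Finset.sum_congr rfl fun _ _ => Finset.sum_congr rfl fun _ _ => by ring

theorem toEuclideanLin_mul_apply (M N : Matrix (Fin d) (Fin d) ℂ) (x : CSpace d) :
    Matrix.toEuclideanLin (M * N) x = Matrix.toEuclideanLin M (Matrix.toEuclideanLin N x) := by
  simp [Matrix.toLpLin_apply, Matrix.mulVec_mulVec]

theorem transpose_eq_iff_pairing (M : Matrix (Fin d) (Fin d) ℂ) : M.transpose = M ↔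
    ∀ x y : CSpace d,
      pairing (Matrix.toEuclideanLin M x) y = pairing x (Matrix.toEuclideanLin M y) := by
  refine ⟨fun h x y => by rw [pairing_toEuclideanLin, h], fun h => ?_⟩
  refine Matrix.toEuclideanLin.injective (LinearMap.ext fun x => ext_pairing fun y => ?_)
  rw [pairing_toEuclideanLin, Matrix.transpose_transpose, h]

theorem conjVec_conjTranspose (Q : Matrix (Fin d) (Fin d) ℂ) (x : CSpace d) :
    conjVec (Matrix.toEuclideanLin Q.conjTranspose (conjVec x)) =
      Matrix.toEuclideanLin Q.transpose x := by
  ext j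
  simp [conjVec, Matrix.toLpLin_apply, Matrix.mulVec, dotProduct]

theorem conjVec_add (x y : CSpace d) : conjVec (x + y) = conjVec x + conjVec y := by
  ext j
  simp [conjVec]

theorem conjVec_sub (x y : CSpace d) : conjVec (x - y) = conjVec x - conjVec y := by
  ext j
  simp [conjVec]

theorem differentiable_pairing_left (y : CSpace d) :
    Differentiable ℂ fun x : CSpace d => pairing x y := by
  simp only [← inner_conjVec]
  exact differentiable_inner_right _

theorem differentiable_toEuclideanLin (M : Matrix (Fin d) (Fin d) ℂ) :
    Differentiable ℂ fun x : CSpace d => Matrix.toEuclideanLin M x :=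
  (LinearMap.toContinuousLinearMap (Matrix.toEuclideanLin M)).differentiable

/-- Differentiating e^G = 1 gives G' = 0. This is how exponents are compared without the 2πi
ambiguity. -/
theorem eq_of_forall_exp_eq_one {E : Type*} [NormedAddCommGroup E] [NormedSpace ℂ E] {G : E → ℂ}
    (hG : Differentiable ℂ G) (h : ∀ x, Complex.exp (G x) = 1) (x y : E) : G x = G y := by
  refine is_const_of_fderiv_eq_zero (𝕜 := ℂ) hG (fun z => ?_) x y
  have h1 := (hG z).hasFDerivAt.cexp
  have h2 : (fun x => Complex.exp (G x)) = fun _ => 1 := funext h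
  rw [h2, h z, one_smul] at h1
  exact h1.unique (hasFDerivAt_const _ _)

end Pairing

/-! ### What being a conjugation forces on A and c. -/

section Conjugation

/-- Polarisation: antilinearity exchanges i and -i, which is exactly the effect of swapping the two
arguments. -/
theorem IsConjugation.inner_map_map {H : Type*} [NormedAddCommGroup H] [InnerProductSpace ℂ H]
    {C : H →ₗ⋆[ℂ] H} (hC : IsConjugation C) (f g : H) : inner ℂ (C f) (C g) = inner ℂ g f := by
  have h1 : C f - Complex.I • C g = C (f + Complex.I • g) := by
    rw [map_add, map_smulₛₗ, Complex.conj_I, neg_smul, sub_eq_add_neg]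
  have h2 : C f + Complex.I • C g = C (f - Complex.I • g) := by
    rw [map_sub, map_smulₛₗ, Complex.conj_I, neg_smul, sub_neg_eq_add]
  have h3 : ‖f + Complex.I • g‖ = ‖g - Complex.I • f‖ := by
    rw [← one_mul ‖g - Complex.I • f‖, ← Complex.norm_I, ← norm_smul, smul_sub, smul_smul,
      Complex.I_mul_I, neg_one_smul, sub_neg_eq_add, add_comm]
  have h4 : ‖f - Complex.I • g‖ = ‖g + Complex.I • f‖ := by
    rw [← one_mul ‖g + Complex.I • f‖, ← Complex.norm_I, ← norm_smul, smul_add, smul_smul,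
      Complex.I_mul_I, neg_one_smul, ← sub_eq_add_neg, norm_sub_rev]
  rw [inner_eq_sum_norm_sq_div_four, inner_eq_sum_norm_sq_div_four g f]
  simp only [RCLike.I_to_complex]
  rw [h1, h2, ← map_add, ← map_sub, hC.2, hC.2, hC.2, hC.2, h3, h4, add_comm f g, norm_sub_rev f g]

theorem IsConjugation.inner_map_left {H : Type*} [NormedAddCommGroup H] [InnerProductSpace ℂ H]
    {C : H →ₗ⋆[ℂ] H} (hC : IsConjugation C) (f g : H) : inner ℂ (C f) g = inner ℂ (C g) f := by
  rw [← hC.inner_map_map f (C g), hC.1]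

variable {A : Matrix (Fin d) (Fin d) ℂ} {b : CSpace d} {c : ℂ}
  {C : FockSpace d →ₗ⋆[ℂ] FockSpace d}

theorem map_kernel_apply (hC : ∀ (f : FockSpace d) (z : CSpace d), C f z = conjExpr A b c f z)
    (w u : CSpace d) : C (kernel w) u =
      c * Complex.exp (pairing u b + pairing (Matrix.toEuclideanLin A u + b) w) := by
  rw [hC, conjExpr, kernel_apply, ← Complex.exp_conj, inner_conjVec, inner_eq_pairing,
    conj_pairing, conjVec_conjVec, conjVec_conjVec, mul_assoc, Complex.exp_add]

theorem conj_const_ne_zero (hC : ∀ (f : FockSpace d) (z : CSpace d), C f z = conjExpr A b c f z)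
    (hconj : IsConjugation C) : c ≠ 0 := by
  rintro rfl
  have h1 : C (kernel 0) = 0 := DFunLike.ext _ _ fun u => by
    rw [map_kernel_apply hC, zero_mul, FockSpace.coe_zero]
  have h2 : kernel (0 : CSpace d) = 0 := by rw [← hconj.1 (kernel 0), h1, map_zero]
  have h3 : kernel (0 : CSpace d) 0 = 0 := by rw [h2, FockSpace.coe_zero]
  rw [kernel_apply] at h3
  exact Complex.exp_ne_zero _ h3

/-- Both sides are values on kernels of the symmetric bilinear form (f, g) ↦ ⟨f, C g⟩. -/
theorem map_kernel_symm (hconj : IsConjugation C) (u w : CSpace d) :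
    C (kernel w) u = C (kernel u) w := by
  rw [← inner_kernel, ← inner_kernel, ← hconj.1 (kernel u), hconj.inner_map_map, hconj.1]

/-- In `map_kernel_symm` the exponents differ by Au·w - u·Aw, whose exponential is therefore 1; it
is constant in u and vanishes at u = 0. -/
theorem conj_matrix_symm (hC : ∀ (f : FockSpace d) (z : CSpace d), C f z = conjExpr A b c f z)
    (hconj : IsConjugation C) (u w : CSpace d) :
    pairing (Matrix.toEuclideanLin A u) w = pairing u (Matrix.toEuclideanLin A w) := by
  have hd : Differentiable ℂ fun u : CSpace d =>
      pairing (Matrix.toEuclideanLin A u) w - pairing u (Matrix.toEuclideanLin A w) :=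
    ((differentiable_pairing_left w).comp (differentiable_toEuclideanLin A)).sub
      (differentiable_pairing_left _)
  have h := eq_of_forall_exp_eq_one hd (fun u => ?_) u 0
  · simpa [pairing_zero_left, sub_eq_zero] using h
  · have h1 := map_kernel_symm hconj u w
    rw [map_kernel_apply hC, map_kernel_apply hC] at h1
    have h2 := mul_left_cancel₀ (conj_const_ne_zero hC hconj) h1
    rw [show pairing (Matrix.toEuclideanLin A u) w - pairing u (Matrix.toEuclideanLin A w) =
      (pairing u b + pairing (Matrix.toEuclideanLin A u + b) w) -
        (pairing w b + pairing (Matrix.toEuclideanLin A w + b) u) by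
        rw [pairing_add_left, pairing_add_left, pairing_comm b w, pairing_comm b u,
          pairing_comm _ u]
        ring, Complex.exp_sub, h2, div_self (Complex.exp_ne_zero _)]

/-- If Av = 0, then C K_v is proportional to C K_0, so K_v is constant, which forces v = 0. -/
theorem conj_matrix_injective
    (hC : ∀ (f : FockSpace d) (z : CSpace d), C f z = conjExpr A b c f z)
    (hconj : IsConjugation C) : Function.Injective (Matrix.toEuclideanLin A) := by
  refine (injective_iff_map_eq_zero _).2 fun v hv => ?_
  have h1 : C (kernel v) = C (starRingEnd ℂ (Complex.exp (pairing b v)) • kernel 0) := by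
    rw [map_smulₛₗ, Complex.conj_conj]
    refine DFunLike.ext _ _ fun u => ?_
    rw [FockSpace.coe_smul, map_kernel_apply hC, map_kernel_apply hC, pairing_add_left,
      conj_matrix_symm hC hconj, hv, pairing_zero_right, pairing_zero_right, mul_left_comm,
      ← Complex.exp_add]
    ring_nf
  have h2 := hconj.1.injective h1
  have h3 : ∀ z : CSpace d, kernel v z = starRingEnd ℂ (Complex.exp (pairing b v)) := by
    intro z
    rw [h2, FockSpace.coe_smul, kernel_apply, inner_zero_left, Complex.exp_zero, mul_one]
  have h4 := eq_of_forall_exp_eq_one (differentiable_inner_right v) (fun z => by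
    rw [← kernel_apply, h3, ← h3 0, kernel_apply, inner_zero_right, Complex.exp_zero]) v 0
  rw [inner_zero_right] at h4
  exact inner_self_eq_zero.1 h4

theorem conj_matrix_surjective
    (hC : ∀ (f : FockSpace d) (z : CSpace d), C f z = conjExpr A b c f z)
    (hconj : IsConjugation C) : Function.Surjective (Matrix.toEuclideanLin A) :=
  LinearMap.injective_iff_surjective.1 (conj_matrix_injective hC hconj)

/-- The point z solves Az + b = w̄. The kernel equation describes the operator on the functions C
K_z, and this transfers that description to the kernels themselves. -/
theorem exists_kernel_eq_smul_map_kernel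
    (hC : ∀ (f : FockSpace d) (z : CSpace d), C f z = conjExpr A b c f z)
    (hconj : IsConjugation C) (w : CSpace d) :
    ∃ (α : ℂ) (z : CSpace d), kernel w = α • C (kernel z) := by
  obtain ⟨z, hz⟩ := conj_matrix_surjective hC hconj (conjVec w - b)
  refine ⟨(c * Complex.exp (pairing b z))⁻¹, z, DFunLike.ext _ _ fun u => ?_⟩
  have hc := conj_const_ne_zero hC hconj
  have he := Complex.exp_ne_zero (pairing b z)
  rw [FockSpace.coe_smul, map_kernel_apply hC, kernel_apply, pairing_add_left,
    conj_matrix_symm hC hconj, hz, pairing_sub_right, ← inner_eq_pairing,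
    show pairing u b + (inner ℂ w u - pairing u b + pairing b z) = inner ℂ w u + pairing b z by
      ring, Complex.exp_add]
  field_simp

end Conjugation

/-! ### The kernel equation and the form of the symbols. -/

section Form

variable {A : Matrix (Fin d) (Fin d) ℂ} {b : CSpace d} {c : ℂ}
  {C : FockSpace d →ₗ⋆[ℂ] FockSpace d} {ψ : CSpace d → ℂ} {φ : CSpace d → CSpace d}

/-- The kernel equation: the bilinear form `(f, g) ↦ ⟨f, C g⟩` is symmetric for the weighted
composition operator on the kernel functions. -/
def KernelEquation (C : FockSpace d →ₗ⋆[ℂ] FockSpace d) (ψ : CSpace d → ℂ)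
    (φ : CSpace d → CSpace d) : Prop :=
  ∀ u z, ψ u * C (kernel z) (φ u) = ψ z * C (kernel (φ z)) u

/-- By `map_kernel_symm` the right side is the left with u and z exchanged. In the exponent the term
AQu·z is symmetric because AQ is, and ℓ is chosen so that the affine terms are symmetric too. -/
theorem HasCSForm.kernelEquation
    (hC : ∀ (f : FockSpace d) (z : CSpace d), C f z = conjExpr A b c f z)
    (hconj : IsConjugation C) (h : HasCSForm A b ψ φ) : KernelEquation C ψ φ := by
  obtain ⟨θ, Q, q, l, hψ, hφ, hAQ, rfl⟩ := h
  rw [transpose_eq_iff_pairing] at hAQ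
  simp only [toEuclideanLin_mul_apply] at hAQ
  have hl : ∀ u : CSpace d, inner ℂ (conjVec (Matrix.toEuclideanLin A q) + conjVec b -
      Matrix.toEuclideanLin Q.conjTranspose (conjVec b)) u =
      pairing u (Matrix.toEuclideanLin A q) + pairing u b -
        pairing (Matrix.toEuclideanLin Q u) b := by
    intro u
    rw [inner_eq_pairing, conjVec_sub, conjVec_add, conjVec_conjVec, conjVec_conjVec,
      conjVec_conjTranspose, pairing_sub_right, pairing_add_right, pairing_toEuclideanLin]
  intro u z
  rw [map_kernel_symm hconj u, map_kernel_apply hC, map_kernel_apply hC, hψ, hψ, hφ, hφ, hl, hl,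
    mul_mul_mul_comm, mul_mul_mul_comm θ _ c, ← Complex.exp_add, ← Complex.exp_add]
  congr 2
  simp only [map_add, pairing_add_left]
  rw [hAQ u z, pairing_comm u (Matrix.toEuclideanLin A (Matrix.toEuclideanLin Q z)),
    pairing_comm z (Matrix.toEuclideanLin A q), pairing_comm u (Matrix.toEuclideanLin A q),
    pairing_comm b z, pairing_comm b u]
  ring

/-- Setting z = 0 expresses ψ through φ and ψ(0), which is nonzero since ψ is. Substituting back and
comparing exponents gives A(φ(u) - q)·z = u·A(φ(z) - q) with q = φ(0). The right side is linear in u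
and A is injective, so φ - q is linear; the same identity is the symmetry of AQ. -/
theorem KernelEquation.hasCSForm
    (hC : ∀ (f : FockSpace d) (z : CSpace d), C f z = conjExpr A b c f z)
    (hconj : IsConjugation C) (hψ0 : ψ ≠ 0) (hφ : Differentiable ℂ φ)
    (h : KernelEquation C ψ φ) : HasCSForm A b ψ φ := by
  have hA := conj_matrix_symm hC hconj
  have hc := conj_const_ne_zero hC hconj
  set L := Matrix.toEuclideanLin A
  set q := φ 0
  have h1 : ∀ u z, ψ u * Complex.exp (pairing (φ u) b + pairing (L (φ u) + b) z) =
      ψ z * Complex.exp (pairing u b + pairing (L u + b) (φ z)) := by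
    intro u z
    have := h u z
    rw [map_kernel_apply hC, map_kernel_apply hC, mul_left_comm, mul_left_comm (ψ z)] at this
    exact mul_left_cancel₀ hc this
  have h2 : ∀ u, ψ u = ψ 0 *
      Complex.exp (pairing u b + pairing (L u + b) q - pairing (φ u) b) := by
    intro u
    have := h1 u 0
    rw [pairing_zero_right, add_zero] at this
    rw [Complex.exp_sub, ← mul_div_assoc, ← this, mul_div_cancel_right₀ _ (Complex.exp_ne_zero _)]
  have hψ00 : ψ 0 ≠ 0 := fun h0 => hψ0 (funext fun u => by rw [h2, h0, zero_mul, Pi.zero_apply])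
  have h3 : ∀ u z, pairing (L (φ u) - L q) z = pairing u (L (φ z) - L q) := by
    intro u z
    have hd : Differentiable ℂ fun z : CSpace d => pairing z (L (φ u)) + pairing (L u) q -
        (pairing (φ z) (L u) + pairing z (L q)) :=
      ((differentiable_pairing_left _).add_const _).sub
        (((differentiable_pairing_left _).comp hφ).add (differentiable_pairing_left _))
    have h4 := eq_of_forall_exp_eq_one hd (fun z => ?_) z 0
    · simp only [pairing_zero_left] at h4
      rw [pairing_sub_left, pairing_sub_right, ← hA, ← hA, pairing_comm (L (φ u)),
        pairing_comm (L q), pairing_comm (L u) (φ z)]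
      rw [pairing_comm (φ 0) (L u)] at h4
      linear_combination h4
    · have h4 := h1 u z
      rw [h2 u, h2 z, mul_assoc, mul_assoc, ← Complex.exp_add, ← Complex.exp_add] at h4
      have h5 := mul_left_cancel₀ hψ00 h4
      rw [show pairing z (L (φ u)) + pairing (L u) q - (pairing (φ z) (L u) + pairing z (L q)) =
        pairing u b + pairing (L u + b) q - pairing (φ u) b +
          (pairing (φ u) b + pairing (L (φ u) + b) z) -
        (pairing z b + pairing (L z + b) q - pairing (φ z) b +
          (pairing u b + pairing (L u + b) (φ z))) by
          simp only [pairing_add_left]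
          rw [hA z q, pairing_comm (L (φ u)) z, pairing_comm b z, pairing_comm (L u) (φ z),
            pairing_comm b (φ z)]
          ring, Complex.exp_sub, h5, div_self (Complex.exp_ne_zero _)]
  have hinj := conj_matrix_injective hC hconj
  let Ql : CSpace d →ₗ[ℂ] CSpace d :=
    { toFun := fun u => φ u - q
      map_add' := fun u v => hinj <| ext_pairing fun z => by
        simp only [map_sub, map_add, pairing_add_left]
        rw [← map_sub, ← map_sub, ← map_sub]
        simp only [map_sub]
        rw [h3, h3, h3, pairing_add_left]
      map_smul' := fun a u => hinj <| ext_pairing fun z => by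
        simp only [map_sub, map_smul, RingHom.id_apply, pairing_smul_left]
        rw [h3, h3, pairing_smul_left] }
  set Q := Matrix.toEuclideanLin.symm Ql
  have hQ : ∀ u, Matrix.toEuclideanLin Q u = φ u - q := fun u => by
    rw [LinearEquiv.apply_symm_apply]
    rfl
  refine ⟨ψ 0, Q, q, _, fun u => ?_, fun u => by rw [hQ, sub_add_cancel], ?_, rfl⟩
  · rw [h2, inner_eq_pairing, conjVec_sub, conjVec_add, conjVec_conjVec, conjVec_conjVec,
      conjVec_conjTranspose, pairing_sub_right, pairing_add_right, ← pairing_toEuclideanLin, hQ,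
      pairing_sub_left, pairing_add_left, hA u q, pairing_comm b q]
    congr 2
    ring
  · refine (transpose_eq_iff_pairing _).2 fun u z => ?_
    rw [toEuclideanLin_mul_apply, toEuclideanLin_mul_apply, hQ, hQ, map_sub, map_sub]
    exact h3 u z

end Form

/-! ### Symmetry of the maximal operator, by dilation and analytic continuation. -/

variable {A : Matrix (Fin d) (Fin d) ℂ} {b : CSpace d} {c : ℂ}
  {C : FockSpace d →ₗ⋆[ℂ] FockSpace d} {ψ : CSpace d → ℂ} {φ : CSpace d → CSpace d}

/-- The kernel equation gives g = αψ(x) C K_{φ(x)}, and both sides become αψ(x) h(φ(x)) by the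
reproducing property. Here h is an arbitrary element of the maximal domain. -/
theorem inner_map_eq_of_eq_smul_map_kernel (hconj : IsConjugation C) (hE : KernelEquation C ψ φ)
    {h h' : FockSpace d} (hh : ∀ z, h' z = ψ z * h (φ z)) {g k : FockSpace d} {α : ℂ}
    {x : CSpace d} (hk : k = α • C (kernel x)) (hg : ∀ z, g z = ψ z * k (φ z)) :
    inner ℂ (C h) g = inner ℂ (C h') k := by
  have h1 : g = (α * ψ x) • C (kernel (φ x)) := DFunLike.ext _ _ fun z => by
    rw [hg, hk, FockSpace.coe_smul, FockSpace.coe_smul, mul_left_comm, hE, mul_assoc]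
  rw [h1, hk, inner_smul_right, inner_smul_right, hconj.inner_map_map, hconj.inner_map_map,
    inner_kernel, inner_kernel, hh, mul_assoc]

theorem inner_map_dilate_eq_of_small
    (hC : ∀ (f : FockSpace d) (z : CSpace d), C f z = conjExpr A b c f z)
    (hconj : IsConjugation C) (hE : KernelEquation C ψ φ) {θ : ℂ} {l q : CSpace d}
    {Q : CSpace d →L[ℂ] CSpace d} (hψ : ∀ z, ψ z = θ * Complex.exp (inner ℂ l z))
    (hφ : ∀ z, φ z = Q z + q) {f f' h h' : FockSpace d} (hf : ∀ z, f' z = ψ z * f (φ z))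
    (hh : ∀ z, h' z = ψ z * h (φ z)) {r : ℂ} (hr : ‖r‖ < 1) (hrQ : ‖r • Q‖ < 1) :
    inner ℂ (C h) (dilate l 0 f' r) = inner ℂ (C h') (dilate 0 q f r) := by
  have hrid := (norm_smul_id_le (d := d) r).trans_lt hr
  -- The weight e^{(1-r)⟨z,ℓ⟩} restores the exponential factor that rescaling ψ loses, leaving θ
  -- e^{⟨z,ℓ⟩} f(rQz + q), bounded in f because ‖rQ‖ < 1.
  have h1 : dilate l 0 f' r = (θ • gaussOp (r • Q) hrQ l q) f := DFunLike.ext _ _ fun z => by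
    rw [dilate_apply _ _ _ hr, hf, hψ, hφ, smul_apply, FockSpace.coe_smul,
      gaussOp_apply, smul_zero, add_zero, map_smul, inner_smul_right,
      smul_apply, mul_left_comm, mul_assoc θ, ← mul_assoc (Complex.exp _) (Complex.exp _),
      ← Complex.exp_add]
    congr 4
    ring
  have h2 : dilate 0 q f r = gaussOp (r • ContinuousLinearMap.id ℂ (CSpace d)) hrid 0
      ((1 - r) • q) f := by
    rw [dilate, dif_pos hr, smul_zero]
  have h3 : (innerSL ℂ (C h)).comp (θ • gaussOp (r • Q) hrQ l q) =
      (innerSL ℂ (C h')).comp (gaussOp (r • ContinuousLinearMap.id ℂ (CSpace d)) hrid 0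
        ((1 - r) • q)) := by
    -- Both sides are now bounded functionals of f, so kernels suffice; dilation sends K_w to a
    -- multiple of K_{r̄w}, which is again a multiple of some C K_x.
    refine ContinuousLinearMap.ext_on dense_span_kernel ?_
    rintro _ ⟨w, rfl⟩
    have h4 : gaussOp (r • ContinuousLinearMap.id ℂ (CSpace d)) hrid 0 ((1 - r) • q) (kernel w) =
        Complex.exp ((1 - r) * inner ℂ w q) • kernel (starRingEnd ℂ r • w) :=
      DFunLike.ext _ _ fun z => by
        rw [gaussOp_apply, inner_zero_left, Complex.exp_zero, one_mul, FockSpace.coe_smul,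
          kernel_apply, kernel_apply, inner_add_right, inner_smul_right, inner_smul_left,
          Complex.conj_conj, smul_apply, ContinuousLinearMap.id_apply,
          inner_smul_right, Complex.exp_add, mul_comm]
    obtain ⟨α, x, hx⟩ := exists_kernel_eq_smul_map_kernel hC hconj (starRingEnd ℂ r • w)
    rw [hx, smul_smul] at h4
    refine inner_map_eq_of_eq_smul_map_kernel hconj hE hh h4 fun z => ?_
    rw [ContinuousLinearMap.coe_coe, ContinuousLinearMap.coe_coe, smul_apply, FockSpace.coe_smul,
      gaussOp_apply, gaussOp_apply,
      inner_zero_left, Complex.exp_zero, one_mul, hψ, hφ, mul_assoc]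
    simp only [smul_apply, ContinuousLinearMap.id_apply]
    -- Contracting about q = φ(0) after φ has the same effect as replacing Q by rQ.
    rw [show r • (Q z + q) + (1 - r) • q = r • Q z + q by module]
  rw [h1, h2]
  exact DFunLike.congr_fun h3 f

/-- The maximal weighted composition operator is symmetric for the bilinear form
`(f, h) ↦ ⟨f, C h⟩`. -/
theorem HasCSForm.inner_map_eq
    (hC : ∀ (f : FockSpace d) (z : CSpace d), C f z = conjExpr A b c f z)
    (hconj : IsConjugation C) (hform : HasCSForm A b ψ φ) {f f' h h' : FockSpace d}
    (hf : ∀ z, f' z = ψ z * f (φ z)) (hh : ∀ z, h' z = ψ z * h (φ z)) :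
    inner ℂ (C h) f' = inner ℂ (C h') f := by
  have hE := hform.kernelEquation hC hconj
  obtain ⟨θ, Q, q, l, hψ, hφ, -, -⟩ := hform
  set L : CSpace d →L[ℂ] CSpace d := LinearMap.toContinuousLinearMap (Matrix.toEuclideanLin Q)
  have hsmall : ∀ᶠ r : ℂ in 𝓝 0,
      inner ℂ (C h) (dilate l 0 f' r) = inner ℂ (C h') (dilate 0 q f r) := by
    have h1 : ∀ᶠ r : ℂ in 𝓝 0, ‖r‖ < 1 :=
      (continuous_norm.tendsto (0 : ℂ)).eventually_lt_const (by simp)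
    have h2 : ∀ᶠ r : ℂ in 𝓝 0, ‖r • L‖ < 1 := by
      have hc : Continuous fun r : ℂ => ‖r‖ * ‖L‖ := by fun_prop
      filter_upwards [(hc.tendsto 0).eventually_lt_const (u := 1) (by simp)] with r hr
      exact (ContinuousLinearMap.opNorm_smul_le r L).trans_lt hr
    filter_upwards [h1, h2] with r hr1 hr2
    exact inner_map_dilate_eq_of_small hC hconj hE hψ hφ hf hh hr1 hr2
  have hball : IsPreconnected (Metric.ball (0 : ℂ) 1) := (convex_ball _ _).isPreconnected
  -- Since ‖Q‖ is arbitrary, the direct argument reaches only small r. Both sides are holomorphic on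
  -- the unit disc because f and f' lie in the space, so the identity theorem extends the equality
  -- towards r = 1.
  have heq := AnalyticOnNhd.eqOn_of_preconnected_of_eventuallyEq
    ((differentiableOn_inner_dilate l 0 f' (C h)).analyticOnNhd Metric.isOpen_ball)
    ((differentiableOn_inner_dilate 0 q f (C h')).analyticOnNhd Metric.isOpen_ball)
    hball (Metric.mem_ball_self one_pos) hsmall
  refine tendsto_nhds_unique (tendsto_inner_dilate l 0 f' (C h))
    ((tendsto_inner_dilate 0 q f (C h')).congr' ?_)
  have hgt : ∀ᶠ r : ℝ in 𝓝[<] 1, 0 < r :=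
    mem_nhdsWithin_of_mem_nhds (eventually_gt_nhds one_pos)
  filter_upwards [self_mem_nhdsWithin, hgt] with r hr1 hr0
  refine (heq ?_).symm
  rw [mem_ball_zero_iff, Complex.norm_real, Real.norm_of_nonneg hr0.le]
  exact hr1

/-! ### Adjoints and C-selfadjointness. -/

section Operators

variable {T : FockSpace d →ₗ.[ℂ] FockSpace d}

theorem mem_maxWCO_domain {f : FockSpace d} : f ∈ (maxWCO ψ φ).domain ↔
    ∃ g : FockSpace d, ∀ z, g z = ψ z * f (φ z) :=
  ⟨fun hf => ⟨maxWCO ψ φ ⟨f, hf⟩, fun _ => rfl⟩, fun ⟨g, hg⟩ => by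
    have h : (g : CSpace d → ℂ) = wcExpr ψ φ f := funext hg
    change wcExpr ψ φ f ∈ fockSubmodule d
    rw [← h]
    exact g.2⟩

theorem maxWCO_apply (f : (maxWCO ψ φ).domain) (z : CSpace d) :
    maxWCO ψ φ f z = ψ z * f.1 (φ z) := rfl

theorem apply_of_le_maxWCO (hT : T ≤ maxWCO ψ φ) (f : T.domain) (z : CSpace d) :
    T f z = ψ z * f.1 (φ z) := by
  rw [hT.2 (show f.1 = (⟨f.1, hT.1 f.2⟩ : (maxWCO ψ φ).domain).1 from rfl), maxWCO_apply]

/-- Maximality makes the graph an intersection of conditions on point values, each closed since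
evaluations are continuous. -/
theorem isClosed_maxWCO (ψ : CSpace d → ℂ) (φ : CSpace d → CSpace d) :
    (maxWCO ψ φ).IsClosed := by
  have h : ((maxWCO ψ φ).graph : Set (FockSpace d × FockSpace d)) =
      ⋂ z, {p | p.2 z = ψ z * p.1 (φ z)} := by
    ext p
    simp only [SetLike.mem_coe, LinearPMap.mem_graph_iff, Set.mem_iInter, Set.mem_ofPred_eq]
    constructor
    · rintro ⟨f, h1, h2⟩ z
      rw [← h1, ← h2, maxWCO_apply]
    · intro hp
      exact ⟨⟨p.1, mem_maxWCO_domain.2 ⟨p.2, hp⟩⟩, rfl,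
        DFunLike.ext _ _ fun z => (hp z).symm⟩
  rw [LinearPMap.IsClosed, h]
  exact isClosed_iInter fun z => isClosed_eq ((continuous_eval z).comp continuous_snd)
    (continuous_const.mul ((continuous_eval (φ z)).comp continuous_fst))

theorem inner_adjoint_kernel (hT : T ≤ maxWCO ψ φ) (z : CSpace d) (f : T.domain) :
    inner ℂ (starRingEnd ℂ (ψ z) • kernel (φ z)) (f : FockSpace d) = inner ℂ (kernel z) (T f) := by
  rw [inner_smul_left, Complex.conj_conj, inner_kernel, inner_kernel, apply_of_le_maxWCO hT]

/-- The adjoint is explicit on kernels, so C T* C is explicit on C K_z; as it equals T, it must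
agree there with f ↦ ψ · (f ∘ φ). -/
theorem IsCSelfAdjoint.kernelEquation (hconj : IsConjugation C) (hT : T ≤ maxWCO ψ φ)
    (h : IsCSelfAdjoint C T) : KernelEquation C ψ φ := by
  obtain ⟨-, hdense, heq⟩ := h
  intro u z
  have h1 : kernel z ∈ T.adjoint.domain :=
    LinearPMap.mem_adjoint_domain_of_exists _ ⟨_, inner_adjoint_kernel hT z⟩
  have h2 : T.adjoint ⟨kernel z, h1⟩ = starRingEnd ℂ (ψ z) • kernel (φ z) :=
    LinearPMap.adjoint_apply_eq hdense _ (inner_adjoint_kernel hT z)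
  have h3 : C (kernel z) ∈ (conjBy C T.adjoint).domain := by
    change C (C (kernel z)) ∈ T.adjoint.domain
    rwa [hconj.1]
  have h4 : conjBy C T.adjoint ⟨C (kernel z), h3⟩ = ψ z • C (kernel (φ z)) := by
    have h5 : (⟨C (C (kernel z)), h3⟩ : T.adjoint.domain) = ⟨kernel z, h1⟩ :=
      Subtype.ext (hconj.1 _)
    change C (T.adjoint ⟨C (C (kernel z)), h3⟩) = _
    rw [h5, h2, map_smulₛₗ, Complex.conj_conj]
  have h6 := (heq.symm.le.trans hT).2 (x := ⟨C (kernel z), h3⟩)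
    (y := ⟨C (kernel z), (heq.symm.le.trans hT).1 h3⟩) rfl
  rw [h4] at h6
  have h7 := DFunLike.congr_fun h6 u
  rw [FockSpace.coe_smul, maxWCO_apply] at h7
  exact h7.symm

/-- Symmetry of the form exhibits C(Wh) as the value of T* at C h. Allowing a restriction T, rather
than W alone, is what rules out proper C-selfadjoint restrictions. -/
theorem HasCSForm.maxWCO_le_conjBy_adjoint
    (hC : ∀ (f : FockSpace d) (z : CSpace d), C f z = conjExpr A b c f z)
    (hconj : IsConjugation C) (hform : HasCSForm A b ψ φ) (hT : T ≤ maxWCO ψ φ)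
    (hdense : Dense (T.domain : Set (FockSpace d))) :
    maxWCO ψ φ ≤ conjBy C T.adjoint := by
  have key : ∀ (h : (maxWCO ψ φ).domain) (f : T.domain),
      inner ℂ (C (maxWCO ψ φ h)) (f : FockSpace d) = inner ℂ (C h) (T f) := fun h f =>
    (hform.inner_map_eq hC hconj (apply_of_le_maxWCO hT f) (maxWCO_apply h)).symm
  refine ⟨fun h hh => LinearPMap.mem_adjoint_domain_of_exists (C h)
    ⟨C (maxWCO ψ φ ⟨h, hh⟩), key ⟨h, hh⟩⟩, ?_⟩
  rintro ⟨h, hh⟩ ⟨_, hh'⟩ rfl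
  have h1 : T.adjoint ⟨C h, hh'⟩ = C (maxWCO ψ φ ⟨h, hh⟩) :=
    LinearPMap.adjoint_apply_eq hdense _ (key ⟨h, hh⟩)
  change _ = C (T.adjoint ⟨C h, hh'⟩)
  rw [h1, hconj.1]

theorem KernelEquation.map_kernel_mem_domain (hE : KernelEquation C ψ φ) (z : CSpace d) :
    C (kernel z) ∈ (maxWCO ψ φ).domain :=
  mem_maxWCO_domain.2 ⟨ψ z • C (kernel (φ z)), fun u => (hE u z).symm⟩

/-- The domain contains every C K_z; a function orthogonal to all of them has C f = 0 pointwise. -/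
theorem KernelEquation.dense_domain (hconj : IsConjugation C) (hE : KernelEquation C ψ φ) :
    Dense ((maxWCO ψ φ).domain : Set (FockSpace d)) := by
  refine Dense.mono (Submodule.span_le.2 ?_)
    (dense_span_of_forall_eq_zero (s := Set.range fun z => C (kernel z)) fun f hf => ?_)
  · rintro _ ⟨z, rfl⟩
    exact hE.map_kernel_mem_domain z
  · refine hconj.1.injective (DFunLike.ext _ _ fun z => ?_)
    have h := hf _ ⟨z, rfl⟩
    rw [hconj.inner_map_left] at h
    rw [map_zero, ← inner_kernel, ← inner_conj_symm, h, map_zero, FockSpace.coe_zero]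

/-- The value of C W* C h at z is ⟨C K_z, W* C h⟩ = ⟨W C K_z, C h⟩ = ψ(z)⟨C K_{φ(z)}, C h⟩ = ψ(z)
h(φ(z)). -/
theorem KernelEquation.conjBy_adjoint_le (hconj : IsConjugation C) (hE : KernelEquation C ψ φ) :
    conjBy C (maxWCO ψ φ).adjoint ≤ maxWCO ψ φ := by
  have hdense := hE.dense_domain hconj
  have key : ∀ (h : (conjBy C (maxWCO ψ φ).adjoint).domain) (z : CSpace d),
      conjBy C (maxWCO ψ φ).adjoint h z = ψ z * h.1 (φ z) := by
    intro h z
    have h1 := LinearPMap.adjoint_isFormalAdjoint hdense ⟨C h.1, h.2⟩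
      ⟨C (kernel z), hE.map_kernel_mem_domain z⟩
    have h2 : maxWCO ψ φ ⟨C (kernel z), hE.map_kernel_mem_domain z⟩ =
        ψ z • C (kernel (φ z)) := DFunLike.ext _ _ fun u => hE u z
    rw [h2, inner_smul_right, hconj.inner_map_map, inner_kernel] at h1
    rw [← h1, ← inner_kernel]
    change inner ℂ (kernel z) (C _) = _
    conv_lhs => rw [← hconj.1 (kernel z), hconj.inner_map_map]
  refine ⟨fun h hh => mem_maxWCO_domain.2 ⟨_, key ⟨h, hh⟩⟩, ?_⟩
  rintro ⟨h, hh⟩ ⟨_, hh'⟩ rfl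
  exact DFunLike.ext _ _ fun z => key ⟨h, hh⟩ z

theorem HasCSForm.isCSelfAdjoint_maxWCO
    (hC : ∀ (f : FockSpace d) (z : CSpace d), C f z = conjExpr A b c f z)
    (hconj : IsConjugation C) (hform : HasCSForm A b ψ φ) :
    IsCSelfAdjoint C (maxWCO ψ φ) :=
  have hE := hform.kernelEquation hC hconj
  have hdense := hE.dense_domain hconj
  ⟨isClosed_maxWCO ψ φ, hdense, le_antisymm
    (hform.maxWCO_le_conjBy_adjoint hC hconj le_rfl hdense) (hE.conjBy_adjoint_le hconj)⟩

end Operators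

end FockCS

end

theorem theorem1p2 (d : ℕ) (A : Matrix (Fin d) (Fin d) ℂ) (b : FockCS.CSpace d) (c : ℂ)
    (C : FockCS.FockSpace d →ₗ⋆[ℂ] FockCS.FockSpace d)
    (hC : ∀ (f : FockCS.FockSpace d) (z : FockCS.CSpace d), C f z = FockCS.conjExpr A b c f z)
    (hconj : FockCS.IsConjugation C)
    (ψ : FockCS.CSpace d → ℂ) (hψ : Differentiable ℂ ψ) (hψ0 : ψ ≠ 0)
    (φ : FockCS.CSpace d → FockCS.CSpace d) (hφ : Differentiable ℂ φ) :
    (FockCS.IsCSelfAdjoint C (FockCS.maxWCO ψ φ) ↔ FockCS.HasCSForm A b ψ φ) ∧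
    ∀ T : FockCS.FockSpace d →ₗ.[ℂ] FockCS.FockSpace d, T ≤ FockCS.maxWCO ψ φ →
      (FockCS.IsCSelfAdjoint C T ↔ T = FockCS.maxWCO ψ φ ∧ FockCS.HasCSForm A b ψ φ) := by
  have hform : ∀ T : FockCS.FockSpace d →ₗ.[ℂ] FockCS.FockSpace d, T ≤ FockCS.maxWCO ψ φ →
      FockCS.IsCSelfAdjoint C T → FockCS.HasCSForm A b ψ φ := fun T hT h =>
    (h.kernelEquation hconj hT).hasCSForm hC hconj hψ0 hφ
  refine ⟨⟨hform _ le_rfl, fun h => h.isCSelfAdjoint_maxWCO hC hconj⟩, fun T hT => ⟨fun h => ?_, ?_⟩⟩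
  · have hf := hform T hT h
    -- The chain T ≤ W ≤ C T* C = T collapses.
    exact ⟨le_antisymm hT ((hf.maxWCO_le_conjBy_adjoint hC hconj hT h.2.1).trans h.2.2.symm.le), hf⟩
  · rintro ⟨rfl, hf⟩
    exact hf.isCSelfAdjoint_maxWCO hC hconj
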